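/- Let $a,b,c:\mathbb R\to\mathbb R$ be smooth and let $m:\mathbb R^2\to\mathbb C$ be smooth and compactly supported. Write $\widehat f(\xi)=(2\pi)^{-1/2}\int e^{-ix\xi}f(x)\,dx$, let $a(D)$ be the Fourier multiplier with symbol $a$ (similarly $b(D)$, $c(D)$), and put $T_m(v,w)(x)=\iint e^{ix(\xi+\eta)}\,\widehat v(\xi)\,\widehat w(\eta)\,m(\xi,\eta)\,d\xi\,d\eta$. For $f,g\in L^2(\mathbb R;\mathbb C)$ consider $$i\partial_t u+a(D)u=T_m(v,w),\qquad i\partial_t v+b(D)v=0,\qquad i\partial_t w+c(D)w=0,\qquad u(0)=0,\ v(0)=f,\ w(0)=g.$$ This system has a unique weak solution $(u,v,w)$ with $u,v,w\in C(\mathbb R;L^2(\mathbb R))$, the test functions being those whose Fourier transform is smooth and compactly supported. Let $\phi(\xi,\eta)=-a(\xi+\eta)+b(\xi)+c(\eta)$ and $\Gamma=\{(\xi,\eta)\in\mathbb R^2:\phi(\xi,\eta)=0\}$. Then for every $q\in[2,\infty]$ there is a constant $C$, independent of $f$, $g$ and $t$, such that $$\|u(t)\|_{L^q}\le C\,\alpha(t)\,\|f\|_{L^2}\|g\|_{L^2}\qquad\text{for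 all } t\ge 0,$$ in each of the following situations (with $1/q=0$ if $q=\infty$): - in general, with $\alpha(t)=t$; - if $\Gamma=\emptyset$, with $\alpha(t)=1$; - if $\Gamma$ is a single point at which $\phi$ vanishes at order two, that is, $\nabla\phi=0$ and the Hessian of $\phi$ is positive or negative definite there, with $\alpha(t)=t^{\frac12+\frac1{2q}}$; - if $\Gamma$ is a smooth curve on which $\phi$ vanishes at order one (that is, $\nabla\phi\ne0$ on $\Gamma$) and which is nowhere characteristic (that is, no tangent of $\Gamma$ is parallel to $(1,0)$, $(0,1)$ or $(1,-1)$), with $\alpha(t)=t^{\frac1q}$ if $q<\infty$ and $\alpha(t)=\sqrt{1+\log^2 t}$ if $q=\infty$ (at $t=0$, where $u=0$, read $\log 0=0$); - if $\Gamma$ is a smooth curve with nowhere vanishing curvature on which $\phi$ vanishes at order one, with $\alpha(t)=t^{\frac14+\frac1{2q}}$; - if $\Gamma$ is any smooth curve on which $\phi$ vanishes at order one, with $\alpha(t)=t^{\frac12}$. Here a smooth curve is an embedded smooth one-dimensional submanifold of $\mathbb R^2$. -/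

import Mathlib

open MeasureTheory Set Filter Topology
open scoped ENNReal ContDiff FourierTransform ComplexConjugate

noncomputable section

/-- The space `L²(ℝ; ℂ)`. -/
abbrev L2 : Type := Lp ℂ 2 (volume : Measure ℝ)

/-- The unitary Fourier transform on `L²(ℝ)`, normalised so that
`f̂(ξ) = (2π)^{-1/2} ∫ e^{-ixξ} f(x) dx` for integrable `f`.
(Mathlib's `𝓕` has the kernel `e^{-2πixξ}`.) It is a function defined up to null sets. -/
def hatL2 (f : L2) (ξ : ℝ) : ℂ :=
  (((Real.sqrt (2 * Real.pi))⁻¹ : ℝ) : ℂ) * (𝓕 f : L2) (ξ / (2 * Real.pi))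

/-- The inverse Fourier transform `(2π)^{-1/2} ∫ e^{ixξ} χ(ξ) dξ` of an integrable function. -/
def invHat (χ : ℝ → ℂ) (x : ℝ) : ℂ :=
  (((Real.sqrt (2 * Real.pi))⁻¹ : ℝ) : ℂ) *
    ∫ ξ : ℝ, Complex.exp (Complex.I * ((x * ξ : ℝ) : ℂ)) * χ ξ

/-- The bilinear Fourier multiplier
`T_m(f,g)(x) = ∫∫ e^{ix(ξ+η)} f̂(ξ) ĝ(η) m(ξ,η) dξ dη`. -/
def bilinearMultiplier (m : ℝ × ℝ → ℂ) (f g : L2) (x : ℝ) : ℂ :=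
  ∫ p : ℝ × ℝ, Complex.exp (Complex.I * ((x * (p.1 + p.2) : ℝ) : ℂ)) *
    hatL2 f p.1 * hatL2 g p.2 * m p

/-- `u ∈ C(ℝ; L²)` is a (weak) solution of `i ∂ₜ u + a(D) u = N`, `u(0) = u₀`, with `a` real-valued
and `N t : ℝ → ℂ`. The test functions are the `ψ = invHat χ` whose Fourier transform `χ` is
smooth and compactly supported, and then `a(D) ψ = invHat (a χ)`; the equation reads
`d/dt ⟨u(t), ψ⟩ = i (⟨u(t), a(D) ψ⟩ - ⟨N(t), ψ⟩)`, where `⟨F, G⟩ = ∫ F (conj G)`. -/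
structure SolvesDispersive (a : ℝ → ℝ) (N : ℝ → ℝ → ℂ) (u₀ : L2) (u : ℝ → L2) : Prop where
  continuous : Continuous u
  initial : u 0 = u₀
  equation : ∀ χ : ℝ → ℂ, ContDiff ℝ ∞ χ → HasCompactSupport χ → ∀ t : ℝ,
    HasDerivAt (fun s : ℝ => ∫ x : ℝ, u s x * conj (invHat χ x))
      (Complex.I * ((∫ x : ℝ, u t x * conj (invHat (fun ξ => (a ξ : ℂ) * χ ξ) x))
        - ∫ x : ℝ, N t x * conj (invHat χ x))) t

/-- `U = (u, v, w)` solves the system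
`i ∂ₜ u + a(D) u = T_m(v, w)`, `i ∂ₜ v + b(D) v = 0`, `i ∂ₜ w + c(D) w = 0`
with data `u(0) = 0`, `v(0) = f`, `w(0) = g`. -/
structure IsSolution (a b c : ℝ → ℝ) (m : ℝ × ℝ → ℂ) (f g : L2)
    (U : (ℝ → L2) × (ℝ → L2) × (ℝ → L2)) : Prop where
  eq_u : SolvesDispersive a (fun t => bilinearMultiplier m (U.2.1 t) (U.2.2 t)) 0 U.1
  eq_v : SolvesDispersive b (fun _ _ => 0) f U.2.1
  eq_w : SolvesDispersive c (fun _ _ => 0) g U.2.2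

/-- The phase `φ(ξ,η) = -a(ξ+η) + b(ξ) + c(η)`. -/
def phase (a b c : ℝ → ℝ) (p : ℝ × ℝ) : ℝ := -a (p.1 + p.2) + b p.1 + c p.2

/-- The time-resonant set `Γ = {φ = 0}`. -/
def timeResonantSet (a b c : ℝ → ℝ) : Set (ℝ × ℝ) := {p | phase a b c p = 0}

/-- `F` vanishes at order (exactly) one at `p`. -/
def VanishesAtOrderOne (F : ℝ × ℝ → ℝ) (p : ℝ × ℝ) : Prop :=
  F p = 0 ∧ fderiv ℝ F p ≠ 0

/-- `F` vanishes at order (exactly) two at `p`, in the sense appropriate to an isolated zero: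
`F` and `∇F` vanish at `p`, and the Hessian of `F` at `p` is definite. -/
def VanishesAtOrderTwo (F : ℝ × ℝ → ℝ) (p : ℝ × ℝ) : Prop :=
  F p = 0 ∧ fderiv ℝ F p = 0 ∧
    ((∀ v : ℝ × ℝ, v ≠ 0 → 0 < fderiv ℝ (fderiv ℝ F) p v v) ∨
      (∀ v : ℝ × ℝ, v ≠ 0 → fderiv ℝ (fderiv ℝ F) p v v < 0))

/-- `γ` is a smooth regular parametrization of the set `Γ` near its point `p = γ 0`: it maps
neighbourhoods of `0` onto neighbourhoods of `p` in `Γ`. -/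
structure IsLocalParam (Γ : Set (ℝ × ℝ)) (p : ℝ × ℝ) (γ : ℝ → ℝ × ℝ) : Prop where
  smooth : ContDiff ℝ ∞ γ
  base : γ 0 = p
  regular : deriv γ 0 ≠ 0
  map_nhds : Filter.map γ (𝓝 0) = 𝓝[Γ] p

/-- `Γ` is a smooth (embedded) curve in the plane. -/
def IsSmoothCurve (Γ : Set (ℝ × ℝ)) : Prop :=
  ∀ p ∈ Γ, ∃ γ : ℝ → ℝ × ℝ, IsLocalParam Γ p γ

/-- A vector is characteristic if it is tangent to one of the lines
`ξ = const`, `η = const`, `ξ + η = const`. -/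
def IsCharacteristic (τ : ℝ × ℝ) : Prop := τ.1 = 0 ∨ τ.2 = 0 ∨ τ.1 + τ.2 = 0

/-- `Γ` is a smooth curve, no tangent of which is characteristic. -/
def IsNonCharacteristicCurve (Γ : Set (ℝ × ℝ)) : Prop :=
  ∀ p ∈ Γ, ∃ γ : ℝ → ℝ × ℝ, IsLocalParam Γ p γ ∧ ¬ IsCharacteristic (deriv γ 0)

/-- The signed curvature `(x' y'' - y' x'') / (x'² + y'²)^{3/2}` of a parametrized plane curve. -/
def signedCurvature (γ : ℝ → ℝ × ℝ) (s : ℝ) : ℝ :=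
  ((deriv γ s).1 * (deriv (deriv γ) s).2 - (deriv γ s).2 * (deriv (deriv γ) s).1) /
    Real.sqrt ((deriv γ s).1 ^ 2 + (deriv γ s).2 ^ 2) ^ 3

/-- `Γ` is a smooth curve, the curvature of which vanishes nowhere. -/
def IsCurvedCurve (Γ : Set (ℝ × ℝ)) : Prop :=
  ∀ p ∈ Γ, ∃ γ : ℝ → ℝ × ℝ, IsLocalParam Γ p γ ∧ signedCurvature γ 0 ≠ 0

/-- The bound `‖u(t)‖_{L^q} ≲ α(t) ‖f‖_{L²} ‖g‖_{L²}` for the solution of the system and all times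
`t ≥ 0`; the implicit constant does not depend on `f`, `g`, `t`. -/
def SolutionBound (a b c : ℝ → ℝ) (m : ℝ × ℝ → ℂ) (q : ℝ≥0∞) (α : ℝ → ℝ) : Prop :=
  ∃ C : ℝ, ∀ (f g : L2) (U : (ℝ → L2) × (ℝ → L2) × (ℝ → L2)), IsSolution a b c m f g U →
    ∀ t : ℝ, 0 ≤ t → eLpNorm (U.1 t) q volume ≤ ENNReal.ofReal (C * α t * ‖f‖ * ‖g‖)

/-- `1/q` as a real number, with `1/∞ = 0`. -/
def recip (q : ℝ≥0∞) : ℝ := (q⁻¹).toReal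

/-- The Japanese bracket `⟨x⟩ = √(1 + x²)`. -/
def japaneseBracket (x : ℝ) : ℝ := Real.sqrt (1 + x ^ 2)

end

noncomputable section

/-! ### The Fourier transform on `L²(ℝ)` -/

/-! On the Fourier side the free evolutions are multiplications by `e^{itb}` and `e^{itc}`.
Duhamel's formula then exhibits `u(t)` as a bilinear multiplier of the data `f`, `g`, with symbol
`m(ξ,η) e^{ita(ξ+η)} ∫₀ᵗ e^{isφ(ξ,η)} ds` up to the constant `-i√(2π)`. This symbol lives on the
support of `m` and has size at most a constant times `min(t, 1/|φ|)`. Nothing else about it is used: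
no smoothness or oscillation enters the estimates.

The basic inequality is `SymbolBound.multiplierBound`. For a symbol of size at most `c`, supported
in a set whose horizontal and vertical slices have lengths at most `l₁` and `l₂`, Cauchy–Schwarz on
the Fourier side gives the factor `c min(l₁,l₂)^{1/2}` for the `L²` norm and `c (l₁l₂)^{1/2}` for
the `L^∞` norm. Interpolation gives `L^q`. If the slices of `{|φ| ≤ δ}` have lengths `O(δ^p)` and
`O(δ^r)`, the indicator of that set thus contributes `δ^κ` with `κ = max(p,r)/q + (p+r)(1/2 - 1/q)`.

Splitting the symbol along `|φ| ~ 2^{-j}`, `2^j ≲ t`, costs `2^{j(1-κ)}` per layer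
(`dyadicBound_of_localSublevel`). The sum is `O(t^{1-κ})` when `κ < 1` and logarithmic when `κ = 1`.
Compactness of the support of `m` makes it enough to know the slices near each point.

The geometry of `Γ` enters only through `p` and `r`. A nonzero first derivative of `φ` along a
coordinate axis gives slices of length `O(δ)`, a nonzero second derivative gives `O(δ^{1/2})`, and
without information the length is `O(1)`. A definite Hessian gives `(1/2, 1/2)`, a noncharacteristic
curve `(1, 1)`, a curved one `(1, 1/2)` and an arbitrary one `(1, 0)`, in some order of the axes.

For the system itself, a solution is constructed with its Fourier transform prescribed by Duhamel's
formula (`exists_solution`). Weak uniqueness (`SolvesDispersive.unique`) then transfers the bound to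
every solution. -/

lemma quasiMeasurePreserving_div_const {c : ℝ} (hc : c ≠ 0) :
    Measure.QuasiMeasurePreserving (fun x : ℝ => x / c) volume volume := by
  refine ⟨by fun_prop, ?_⟩
  simp_rw [div_eq_mul_inv]
  rw [Real.map_volume_mul_right (inv_ne_zero hc)]
  exact Measure.smul_absolutelyContinuous

lemma lintegral_comp_div_const {c : ℝ} (hc : 0 < c) (h : ℝ → ℝ≥0∞) (hh : Measurable h) :
    ∫⁻ x, h (x / c) = ENNReal.ofReal c * ∫⁻ x, h x := by
  have : ∫⁻ x, h x ∂(Measure.map (fun x : ℝ => x * c⁻¹) volume) = ∫⁻ x, h (x / c) := by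
    rw [lintegral_map hh (by fun_prop)]
    simp_rw [div_eq_mul_inv]
  rw [← this, Real.map_volume_mul_right (inv_ne_zero hc.ne'), lintegral_smul_measure, inv_inv,
    abs_of_pos hc, smul_eq_mul]

lemma stronglyMeasurable_hatL2 (f : L2) : StronglyMeasurable (hatL2 f) := by
  unfold hatL2
  refine StronglyMeasurable.const_mul ?_ _
  exact (Lp.stronglyMeasurable (𝓕 f : L2)).comp_measurable (by fun_prop)

lemma measurable_hatL2 (f : L2) : Measurable (hatL2 f) := (stronglyMeasurable_hatL2 f).measurable

lemma eLpNorm_two_sq_eq_lintegral {h : ℝ → ℂ} :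
    eLpNorm h 2 volume ^ 2 = ∫⁻ x, ‖h x‖ₑ ^ 2 := by
  have h := eLpNorm_nnreal_pow_eq_lintegral (f := h) (μ := (volume : Measure ℝ)) (p := 2) two_ne_zero
  simp only [NNReal.coe_ofNat, ENNReal.coe_ofNat, ENNReal.rpow_ofNat] at h
  exact h

lemma lintegral_enorm_sq_coe (f : L2) : ∫⁻ x, ‖f x‖ₑ ^ 2 = ‖f‖ₑ ^ 2 := by
  rw [Lp.enorm_def, eLpNorm_two_sq_eq_lintegral]

/-- Plancherel: the factor `(2π)^{-1}` from the normalisation cancels the Jacobian of `ξ ↦ ξ /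
(2π)`. -/
lemma lintegral_hatL2_sq (f : L2) : ∫⁻ ξ, ‖hatL2 f ξ‖ₑ ^ 2 = ‖f‖ₑ ^ 2 := by
  have hpi : (0 : ℝ) < 2 * Real.pi := by positivity
  have h1 : ∀ ξ, ‖hatL2 f ξ‖ₑ ^ 2 =
      ENNReal.ofReal (2 * Real.pi)⁻¹ * ‖(𝓕 f : L2) (ξ / (2 * Real.pi))‖ₑ ^ 2 := by
    intro ξ
    rw [hatL2, enorm_mul, mul_pow]
    congr 1
    rw [← ofReal_norm, ← ENNReal.ofReal_pow (norm_nonneg _), Complex.norm_real,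
      Real.norm_of_nonneg (by positivity), inv_pow, Real.sq_sqrt hpi.le]
  have hm : Measurable fun x => ‖(𝓕 f : L2) x‖ₑ ^ 2 :=
    ((Lp.stronglyMeasurable (𝓕 f : L2)).measurable.enorm).pow_const 2
  simp_rw [h1]
  have hm' : Measurable fun ξ => ‖(𝓕 f : L2) (ξ / (2 * Real.pi))‖ₑ ^ 2 := by
    exact hm.comp (g := fun x => ‖(𝓕 f : L2) x‖ₑ ^ 2) (by fun_prop : Measurable fun ξ : ℝ => ξ / (2 * Real.pi))
  rw [lintegral_const_mul _ hm',
    lintegral_comp_div_const hpi (fun x => ‖(𝓕 f : L2) x‖ₑ ^ 2) hm, ← mul_assoc,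
    ← ENNReal.ofReal_mul (by positivity), inv_mul_cancel₀ hpi.ne', ENNReal.ofReal_one, one_mul,
    lintegral_enorm_sq_coe, ← ofReal_norm, ← ofReal_norm, Lp.norm_fourier_eq]

lemma eLpNorm_hatL2 (f : L2) : eLpNorm (hatL2 f) 2 volume = ‖f‖ₑ := by
  have h : eLpNorm (hatL2 f) 2 volume ^ 2 = ‖f‖ₑ ^ 2 := by
    rw [eLpNorm_two_sq_eq_lintegral, lintegral_hatL2_sq]
  exact (ENNReal.pow_right_strictMono two_ne_zero).injective h

lemma memLp_hatL2 (f : L2) : MemLp (hatL2 f) 2 volume :=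
  ⟨(stronglyMeasurable_hatL2 f).aestronglyMeasurable, by
    rw [eLpNorm_hatL2]; exact enorm_lt_top⟩

lemma hatL2_congr_of_fourier {f : L2} {h : ℝ → ℂ} (H : (𝓕 f : L2) =ᵐ[volume] h) :
    hatL2 f =ᵐ[volume] fun ξ =>
      (((Real.sqrt (2 * Real.pi))⁻¹ : ℝ) : ℂ) * h (ξ / (2 * Real.pi)) := by
  have hpi : (2 * Real.pi) ≠ 0 := by positivity
  filter_upwards [(quasiMeasurePreserving_div_const hpi).ae_eq_comp H] with ξ hξ
  simp only [hatL2]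
  rw [show (𝓕 f : L2) (ξ / (2 * Real.pi)) = h (ξ / (2 * Real.pi)) from hξ]

lemma hatL2_add (f g : L2) : hatL2 (f + g) =ᵐ[volume] fun ξ => hatL2 f ξ + hatL2 g ξ := by
  have h : (𝓕 (f + g) : L2) =ᵐ[volume] (𝓕 f : L2) + (𝓕 g : L2) := by
    rw [FourierTransform.fourier_add]; exact Lp.coeFn_add _ _
  filter_upwards [hatL2_congr_of_fourier h] with ξ hξ
  rw [hξ]; simp [hatL2, mul_add]

lemma hatL2_smul (k : ℂ) (f : L2) : hatL2 (k • f) =ᵐ[volume] fun ξ => k * hatL2 f ξ := by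
  have h : (𝓕 (k • f) : L2) =ᵐ[volume] k • (𝓕 f : L2) := by
    rw [FourierTransform.fourier_smul]; exact Lp.coeFn_smul _ _
  filter_upwards [hatL2_congr_of_fourier h] with ξ hξ
  rw [hξ]; simp [hatL2]; ring

/-- The unitary Fourier transform as a linear isometry of `L²(ℝ)`. -/
def hatIsometry : L2 →ₗᵢ[ℂ] L2 where
  toFun f := (memLp_hatL2 f).toLp
  map_add' f g := by
    rw [← MemLp.toLp_add]
    exact MemLp.toLp_congr _ _ (hatL2_add f g)
  map_smul' k f := by
    simp only [RingHom.id_apply]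
    rw [← MemLp.toLp_const_smul]
    exact MemLp.toLp_congr _ _ (hatL2_smul k f)
  norm_map' f := by
    simp [Lp.norm_toLp, eLpNorm_hatL2]

lemma coeFn_hatIsometry (f : L2) : hatIsometry f =ᵐ[volume] hatL2 f :=
  MemLp.coeFn_toLp (memLp_hatL2 f)

lemma hatIsometry_eq_iff {f h : L2} : hatIsometry f = h ↔ hatL2 f =ᵐ[volume] h := by
  rw [Lp.ext_iff]
  exact ⟨fun H => (coeFn_hatIsometry f).symm.trans H, fun H => (coeFn_hatIsometry f).trans H⟩

lemma hatL2_injective {f g : L2} (h : hatL2 f =ᵐ[volume] hatL2 g) : f = g :=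
  hatIsometry.injective (hatIsometry_eq_iff.2 (h.trans (coeFn_hatIsometry g).symm))

lemma hatL2_sub (f g : L2) : hatL2 (f - g) =ᵐ[volume] fun ξ => hatL2 f ξ - hatL2 g ξ := by
  have h := coeFn_hatIsometry (f - g)
  rw [map_sub] at h
  filter_upwards [h, Lp.coeFn_sub (hatIsometry f) (hatIsometry g), coeFn_hatIsometry f,
    coeFn_hatIsometry g] with ξ h1 h2 h3 h4
  rw [← h1, h2, Pi.sub_apply, h3, h4]

lemma sqrt_two_pi_ne_zero : ((Real.sqrt (2 * Real.pi) : ℝ) : ℂ) ≠ 0 := by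
  have : (0 : ℝ) < Real.sqrt (2 * Real.pi) := Real.sqrt_pos.2 (by positivity)
  exact_mod_cast this.ne'

lemma memLp_comp_mul_const {B : ℝ → ℂ} {c : ℝ} (hc : 0 < c) {p : ℝ≥0∞}
    (hB : MemLp B p volume) :
    MemLp (fun y => B (c * y)) p volume := by
  have hq : Measure.map (fun x : ℝ => c * x) volume = ENNReal.ofReal |c⁻¹| • volume :=
    Real.map_volume_mul_left hc.ne'
  have h : MemLp B p (Measure.map (fun x : ℝ => c * x) volume) := by
    rw [hq]; exact hB.smul_measure ENNReal.ofReal_ne_top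
  exact h.comp_of_map (by fun_prop)

/-- Surjectivity of the unitary transform. It allows solutions to be defined by prescribing their
Fourier transforms. -/
lemma exists_hatL2_eq {B : ℝ → ℂ} (hB : MemLp B 2 volume) : ∃ u : L2, hatL2 u =ᵐ[volume] B := by
  have hpi : (0 : ℝ) < 2 * Real.pi := by positivity
  have h := (memLp_comp_mul_const hpi hB).const_mul
    ((Real.sqrt (2 * Real.pi) : ℝ) : ℂ)
  refine ⟨𝓕⁻ (h.toLp : L2), ?_⟩
  have h2 : (𝓕 (𝓕⁻ (h.toLp : L2)) : L2) =ᵐ[volume]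
      fun y => ((Real.sqrt (2 * Real.pi) : ℝ) : ℂ) * B (2 * Real.pi * y) := by
    rw [FourierTransform.fourier_fourierInv_eq]; exact h.coeFn_toLp
  filter_upwards [hatL2_congr_of_fourier h2] with ξ hξ
  rw [hξ, mul_div_cancel₀ _ hpi.ne', ← mul_assoc, Complex.ofReal_inv,
    inv_mul_cancel₀ sqrt_two_pi_ne_zero, one_mul]

lemma invHat_eq_fourierInv (χ : ℝ → ℂ) (x : ℝ) :
    invHat χ x = 𝓕⁻ (fun y => ((Real.sqrt (2 * Real.pi) : ℝ) : ℂ) * χ (2 * Real.pi * y)) x := by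
  have hpi : (0 : ℝ) < 2 * Real.pi := by positivity
  have hs : (Real.sqrt (2 * Real.pi)) * Real.sqrt (2 * Real.pi) = 2 * Real.pi :=
    Real.mul_self_sqrt hpi.le
  rw [Real.fourierInv_eq']
  have h := Measure.integral_comp_mul_left
    (fun ξ : ℝ => Complex.exp (Complex.I * ((x * ξ : ℝ) : ℂ)) * χ ξ) (2 * Real.pi)
  have h2 : ∀ v : ℝ, Complex.exp (((2 * Real.pi * inner ℝ v x : ℝ) : ℂ) * Complex.I) •
      (((Real.sqrt (2 * Real.pi) : ℝ) : ℂ) * χ (2 * Real.pi * v)) =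
      ((Real.sqrt (2 * Real.pi) : ℝ) : ℂ) *
        (Complex.exp (Complex.I * ((x * (2 * Real.pi * v) : ℝ) : ℂ)) * χ (2 * Real.pi * v)) := by
    intro v
    have : ((2 * Real.pi * inner ℝ v x : ℝ) : ℂ) * Complex.I =
        Complex.I * ((x * (2 * Real.pi * v) : ℝ) : ℂ) := by
      simp; ring
    rw [this, smul_eq_mul]; ring
  simp_rw [h2]
  rw [integral_const_mul, h, invHat, abs_of_pos (by positivity), Complex.real_smul, ← mul_assoc,
    ← Complex.ofReal_mul]
  congr 3
  have h0 : Real.sqrt (2 * Real.pi) ≠ 0 := (Real.sqrt_pos.2 hpi).ne'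
  field_simp
  rw [sq, hs]

/-- The rescaled `χ` is a Schwartz function, so Fourier inversion on the Schwartz space applies and
is compatible with the transform on `L²`. -/
lemma exists_coe_eq_invHat {χ : ℝ → ℂ} (hχ : ContDiff ℝ ∞ χ) (hs : HasCompactSupport χ) :
    ∃ X : L2, X =ᵐ[volume] invHat χ ∧ hatIsometry X =ᵐ[volume] χ := by
  have hpi : (0 : ℝ) < 2 * Real.pi := by positivity
  have h1 : ContDiff ℝ ∞ fun y => ((Real.sqrt (2 * Real.pi) : ℝ) : ℂ) * χ (2 * Real.pi * y) := by
    fun_prop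
  have h2 : HasCompactSupport
      fun y => ((Real.sqrt (2 * Real.pi) : ℝ) : ℂ) * χ (2 * Real.pi * y) := by
    refine HasCompactSupport.mul_left ?_
    exact hs.comp_homeomorph (Homeomorph.mulLeft₀ (2 * Real.pi) hpi.ne')
  set S := h2.toSchwartzMap h1 with hS
  have hS' : ∀ y, S y = ((Real.sqrt (2 * Real.pi) : ℝ) : ℂ) * χ (2 * Real.pi * y) := fun y => rfl
  refine ⟨(𝓕⁻ S).toLp 2, ?_, ?_⟩
  · filter_upwards [(𝓕⁻ S).coeFn_toLp 2] with x hx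
    rw [hx, SchwartzMap.fourierInv_coe, invHat_eq_fourierInv]
    rfl
  · refine (coeFn_hatIsometry _).trans ?_
    have h3 : (𝓕 ((𝓕⁻ S).toLp 2 : L2) : L2) =ᵐ[volume] S := by
      rw [SchwartzMap.toLp_fourier_eq, FourierTransform.fourier_fourierInv_eq]
      exact S.coeFn_toLp 2
    filter_upwards [hatL2_congr_of_fourier h3] with ξ hξ
    rw [hξ, hS', mul_div_cancel₀ _ hpi.ne', ← mul_assoc, Complex.ofReal_inv,
      inv_mul_cancel₀ sqrt_two_pi_ne_zero, one_mul]

lemma inner_L2_eq_integral (X F : L2) : inner ℂ X F = ∫ x, F x * conj (X x) := by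
  rw [L2.inner_def]; rfl

/-- Parseval for test functions. It moves the weak formulation to the frequency side, where `a(D)`
is multiplication by `a`. -/
lemma integral_mul_conj_invHat {χ : ℝ → ℂ} (hχ : ContDiff ℝ ∞ χ) (hs : HasCompactSupport χ)
    (u : L2) : ∫ x, u x * conj (invHat χ x) = ∫ ξ, hatL2 u ξ * conj (χ ξ) := by
  obtain ⟨X, hX, hX'⟩ := exists_coe_eq_invHat hχ hs
  have h1 : ∫ x, u x * conj (invHat χ x) = inner ℂ X u := by
    rw [inner_L2_eq_integral]
    refine integral_congr_ae ?_
    filter_upwards [hX] with x hx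
    rw [hx]
  rw [h1, ← hatIsometry.inner_map_map, inner_L2_eq_integral]
  refine integral_congr_ae ?_
  filter_upwards [hX', coeFn_hatIsometry u] with x hx hu
  rw [hx, hu]

/-- If the Fourier transform of an `L²` function is integrable, the function is given by the
inversion formula. -/
lemma ae_eq_invHat_of_hatL2_eq {u : L2} {B : ℝ → ℂ} (hu : hatL2 u =ᵐ[volume] B)
    (hB : Integrable B volume) : u =ᵐ[volume] invHat B := by
  have hpi : (0 : ℝ) < 2 * Real.pi := by positivity
  set b : ℝ → ℂ := fun y => ((Real.sqrt (2 * Real.pi) : ℝ) : ℂ) * B (2 * Real.pi * y) with hb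
  have hbi : Integrable b := ((hB.comp_mul_left' hpi.ne').const_mul _)
  have hFu : (𝓕 u : L2) =ᵐ[volume] b := by
    have h := (quasiMeasurePreserving_div_const (inv_ne_zero hpi.ne')).ae_eq_comp hu
    filter_upwards [h] with y hy
    simp only [Function.comp_apply, div_inv_eq_mul, hatL2] at hy
    rw [mul_div_cancel_right₀ _ hpi.ne'] at hy
    rw [hb]
    simp only
    rw [mul_comm (2 * Real.pi) y, ← hy, ← mul_assoc, Complex.ofReal_inv,
      mul_inv_cancel₀ sqrt_two_pi_ne_zero, one_mul]
  have hcont : Continuous (𝓕⁻ b) := by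
    have : (𝓕⁻ b : ℝ → ℂ) = fun x => (𝓕 b) (-x) := by
      ext x; exact Real.fourierInv_eq_fourier_neg b x
    rw [this]
    exact (VectorFourier.fourierIntegral_continuous Real.continuous_fourierChar
      (by fun_prop) hbi).comp continuous_neg
  -- Both sides are tested against real smooth compactly supported `g`. On the left Plancherel in
  -- `L²` applies; on the right, integrability of `b` permits Fubini.
  have key : ∀ᵐ x, u x = (𝓕⁻ b) x := by
    refine ae_eq_of_integral_contDiff_smul_eq
      ((Lp.memLp u).locallyIntegrable (by norm_num)) hcont.locallyIntegrable ?_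
    intro g hg hgs
    have hgc : HasCompactSupport (fun x => (g x : ℂ)) := hgs.comp_left (g := fun r : ℝ => (r : ℂ)) rfl
    have hgd : ContDiff ℝ ∞ (fun x => (g x : ℂ)) := Complex.ofRealCLM.contDiff.comp hg
    set S := hgc.toSchwartzMap hgd with hS
    have hS' : ∀ y, S y = (g y : ℂ) := fun y => rfl
    have e1 : ∫ x, g x • u x = inner ℂ (S.toLp 2 : L2) u := by
      rw [inner_L2_eq_integral]
      refine integral_congr_ae ?_
      filter_upwards [S.coeFn_toLp 2] with x hx
      rw [hx, hS', Complex.conj_ofReal, Complex.real_smul, mul_comm]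
    have e2 : inner ℂ (S.toLp 2 : L2) u = ∫ ξ, inner ℂ ((𝓕 S) ξ) (b ξ) := by
      rw [← Lp.inner_fourier_eq, SchwartzMap.toLp_fourier_eq, L2.inner_def]
      refine integral_congr_ae ?_
      filter_upwards [(𝓕 S).coeFn_toLp 2, hFu] with x hx hx'
      rw [hx, hx']
    -- The multiplication formula: the transform is moved from `S` to `b`, where conjugation turns
    -- it into the inverse transform.
    have e3 := VectorFourier.integral_sesq_fourierIntegral_eq_neg_flip (μ := (volume : Measure ℝ))
      (ν := (volume : Measure ℝ)) (f := (S : ℝ → ℂ)) (g := b) (L := innerₗ ℝ) (innerSL ℂ)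
      Real.continuous_fourierChar continuous_inner S.integrable hbi
    rw [e1, e2]
    refine Eq.trans e3 ?_
    refine integral_congr_ae (Eventually.of_forall fun x => ?_)
    simp only
    rw [show S x = (g x : ℂ) from rfl]
    rw [innerSL_apply_apply]
    have : VectorFourier.fourierIntegral Real.fourierChar volume (-(innerₗ ℝ).flip) b x =
        (𝓕⁻ b) x := by
      rw [Real.fourierInv_eq, VectorFourier.fourierIntegral]
      simp
    rw [this]
    simp [mul_comm]
  filter_upwards [key] with x hx
  rw [hx, invHat_eq_fourierInv]

/-! ### Bilinear Fourier multipliers with kernels of bounded slices -/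

lemma lintegral_mul_sq_le {α : Type*} [MeasurableSpace α] {μ : Measure α} {f g : α → ℝ≥0∞}
    (hf : AEMeasurable f μ) (hg : AEMeasurable g μ) :
    (∫⁻ x, f x * g x ∂μ) ^ 2 ≤ (∫⁻ x, f x ^ 2 ∂μ) * ∫⁻ x, g x ^ 2 ∂μ := by
  have h := ENNReal.lintegral_mul_le_Lp_mul_Lq μ Real.HolderConjugate.two_two hf hg
  simp only [Pi.mul_apply, ENNReal.rpow_ofNat] at h
  refine (pow_le_pow_left₀ zero_le h 2).trans_eq ?_
  rw [mul_pow, ← ENNReal.rpow_natCast, ← ENNReal.rpow_natCast, ← ENNReal.rpow_mul,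
    ← ENNReal.rpow_mul]
  norm_num

lemma lintegral_shear {h : ℝ × ℝ → ℝ≥0∞} (hh : Measurable h) :
    ∫⁻ ζ, ∫⁻ ξ, h (ξ, ζ - ξ) = ∫⁻ ξ, ∫⁻ η, h (ξ, η) := by
  rw [lintegral_lintegral_swap]
  · refine lintegral_congr fun ξ => ?_
    exact lintegral_sub_right_eq_self (fun η => h (ξ, η)) ξ
  · exact (hh.comp (by fun_prop : Measurable fun p : ℝ × ℝ => (p.2, p.1 - p.2))).aemeasurable

/-- A measurable plane set, the horizontal slices of which have length at most `L₁`, and the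
vertical ones length at most `L₂`. -/
structure SliceBound (S : Set (ℝ × ℝ)) (L₁ L₂ : ℝ≥0∞) : Prop where
  measurableSet : MeasurableSet S
  horizontal : ∀ η, volume {ξ | (ξ, η) ∈ S} ≤ L₁
  vertical : ∀ ξ, volume {η | (ξ, η) ∈ S} ≤ L₂

namespace SliceBound

variable {S : Set (ℝ × ℝ)} {L₁ L₂ : ℝ≥0∞} {F G : ℝ → ℝ≥0∞}

lemma lintegral_left_le (hS : SliceBound S L₁ L₂) (hF : Measurable F) :
    ∫⁻ ξ, ∫⁻ η, F ξ * S.indicator 1 (ξ, η) ≤ (∫⁻ ξ, F ξ) * L₂ := by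
  have h1 : ∀ ξ, ∫⁻ η, F ξ * S.indicator 1 (ξ, η) ≤ F ξ * L₂ := by
    intro ξ
    have hm : MeasurableSet {η | (ξ, η) ∈ S} := measurable_prodMk_left hS.measurableSet
    have : ∀ η, S.indicator (1 : ℝ × ℝ → ℝ≥0∞) (ξ, η) =
        {η | (ξ, η) ∈ S}.indicator 1 η := fun η => rfl
    simp_rw [this]
    rw [lintegral_const_mul _ (measurable_one.indicator hm), lintegral_indicator_one hm]
    gcongr
    exact hS.vertical ξ
  refine (lintegral_mono h1).trans_eq ?_
  rw [lintegral_mul_const _ hF]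

lemma lintegral_right_le (hS : SliceBound S L₁ L₂) (hG : Measurable G) :
    ∫⁻ ξ, ∫⁻ η, G η * S.indicator 1 (ξ, η) ≤ (∫⁻ η, G η) * L₁ := by
  have hi : Measurable (S.indicator (1 : ℝ × ℝ → ℝ≥0∞)) := measurable_one.indicator hS.measurableSet
  rw [lintegral_lintegral_swap
    (f := fun ξ η => G η * S.indicator 1 (ξ, η)) (by
      exact ((hG.comp measurable_snd).mul hi).aemeasurable)]
  have h1 : ∀ η, ∫⁻ ξ, G η * S.indicator 1 (ξ, η) ≤ G η * L₁ := by
    intro η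
    have hm : MeasurableSet {ξ | (ξ, η) ∈ S} := measurable_prodMk_right hS.measurableSet
    have : ∀ ξ, S.indicator (1 : ℝ × ℝ → ℝ≥0∞) (ξ, η) =
        {ξ | (ξ, η) ∈ S}.indicator 1 ξ := fun ξ => rfl
    simp_rw [this]
    rw [lintegral_const_mul _ (measurable_one.indicator hm), lintegral_indicator_one hm]
    gcongr
    exact hS.horizontal η
  refine (lintegral_mono h1).trans_eq ?_
  rw [lintegral_mul_const _ hG]

lemma indicator_sq (p : ℝ × ℝ) :
    S.indicator (1 : ℝ × ℝ → ℝ≥0∞) p ^ 2 = S.indicator 1 p := by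
  by_cases h : p ∈ S <;> simp [h]

/-- Cauchy–Schwarz in `ξ` with the indicator attached to `G`. After the shear `ζ = ξ + η`,
integration in `ξ` at fixed `η` measures a horizontal slice. -/
lemma lintegral_sq_le_left (hS : SliceBound S L₁ L₂) (hF : Measurable F) (hG : Measurable G) :
    ∫⁻ ζ, (∫⁻ ξ, F ξ * G (ζ - ξ) * S.indicator 1 (ξ, ζ - ξ)) ^ 2 ≤
      (∫⁻ ξ, F ξ ^ 2) * (∫⁻ η, G η ^ 2) * L₁ := by
  have hi : Measurable (S.indicator (1 : ℝ × ℝ → ℝ≥0∞)) := measurable_one.indicator hS.measurableSet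
  have h1 : ∀ ζ, (∫⁻ ξ, F ξ * G (ζ - ξ) * S.indicator 1 (ξ, ζ - ξ)) ^ 2 ≤
      (∫⁻ ξ, F ξ ^ 2) * ∫⁻ ξ, G (ζ - ξ) ^ 2 * S.indicator 1 (ξ, ζ - ξ) := by
    intro ζ
    have h := lintegral_mul_sq_le (μ := (volume : Measure ℝ)) (f := F)
      (g := fun ξ => G (ζ - ξ) * S.indicator 1 (ξ, ζ - ξ)) hF.aemeasurable (by fun_prop)
    simp only [mul_pow, indicator_sq] at h
    simpa only [mul_assoc] using h
  have hm : Measurable fun p : ℝ × ℝ => G p.2 ^ 2 * S.indicator 1 p := by fun_prop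
  calc _ ≤ ∫⁻ ζ, (∫⁻ ξ, F ξ ^ 2) * ∫⁻ ξ, G (ζ - ξ) ^ 2 * S.indicator 1 (ξ, ζ - ξ) :=
        lintegral_mono h1
    _ = (∫⁻ ξ, F ξ ^ 2) * ∫⁻ ζ, ∫⁻ ξ, G (ζ - ξ) ^ 2 * S.indicator 1 (ξ, ζ - ξ) := by
        refine lintegral_const_mul _ ?_
        exact Measurable.lintegral_prod_right'
          (f := fun p : ℝ × ℝ => G (p.1 - p.2) ^ 2 * S.indicator 1 (p.2, p.1 - p.2)) (by fun_prop)
    _ = (∫⁻ ξ, F ξ ^ 2) * ∫⁻ ξ, ∫⁻ η, G η ^ 2 * S.indicator 1 (ξ, η) := by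
        rw [lintegral_shear hm]
    _ ≤ (∫⁻ ξ, F ξ ^ 2) * ((∫⁻ η, G η ^ 2) * L₁) := by
        gcongr
        exact hS.lintegral_right_le (hG.pow_const 2)
    _ = _ := (mul_assoc _ _ _).symm

/-- The same argument with the indicator attached to `F`, so that vertical slices are measured.
Having both versions produces the minimum of the two lengths. -/
lemma lintegral_sq_le_right (hS : SliceBound S L₁ L₂) (hF : Measurable F) (hG : Measurable G) :
    ∫⁻ ζ, (∫⁻ ξ, F ξ * G (ζ - ξ) * S.indicator 1 (ξ, ζ - ξ)) ^ 2 ≤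
      (∫⁻ ξ, F ξ ^ 2) * (∫⁻ η, G η ^ 2) * L₂ := by
  have hi : Measurable (S.indicator (1 : ℝ × ℝ → ℝ≥0∞)) := measurable_one.indicator hS.measurableSet
  have h1 : ∀ ζ, (∫⁻ ξ, F ξ * G (ζ - ξ) * S.indicator 1 (ξ, ζ - ξ)) ^ 2 ≤
      (∫⁻ η, G η ^ 2) * ∫⁻ ξ, F ξ ^ 2 * S.indicator 1 (ξ, ζ - ξ) := by
    intro ζ
    have h := lintegral_mul_sq_le (μ := (volume : Measure ℝ)) (f := fun ξ => G (ζ - ξ))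
      (g := fun ξ => F ξ * S.indicator 1 (ξ, ζ - ξ)) (by fun_prop) (by fun_prop)
    simp only [mul_pow, indicator_sq] at h
    rw [lintegral_sub_left_eq_self (fun η => G η ^ 2) ζ] at h
    refine le_trans (le_of_eq ?_) h
    congr 1
    refine lintegral_congr fun ξ => ?_
    ring
  have hm : Measurable fun p : ℝ × ℝ => F p.1 ^ 2 * S.indicator 1 p := by fun_prop
  calc _ ≤ ∫⁻ ζ, (∫⁻ η, G η ^ 2) * ∫⁻ ξ, F ξ ^ 2 * S.indicator 1 (ξ, ζ - ξ) :=
        lintegral_mono h1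
    _ = (∫⁻ η, G η ^ 2) * ∫⁻ ζ, ∫⁻ ξ, F ξ ^ 2 * S.indicator 1 (ξ, ζ - ξ) := by
        refine lintegral_const_mul _ ?_
        exact Measurable.lintegral_prod_right'
          (f := fun p : ℝ × ℝ => F p.2 ^ 2 * S.indicator 1 (p.2, p.1 - p.2)) (by fun_prop)
    _ = (∫⁻ η, G η ^ 2) * ∫⁻ ξ, ∫⁻ η, F ξ ^ 2 * S.indicator 1 (ξ, η) := by
        rw [lintegral_shear hm]
    _ ≤ (∫⁻ η, G η ^ 2) * ((∫⁻ ξ, F ξ ^ 2) * L₂) := by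
        gcongr
        exact hS.lintegral_left_le (hF.pow_const 2)
    _ = _ := by ring

/-- An indicator equals its square, so each of the two factors can carry a copy through
Cauchy–Schwarz in the plane; each copy then yields one slice length. -/
lemma lintegral_prod_sq_le (hS : SliceBound S L₁ L₂) (hF : Measurable F) (hG : Measurable G) :
    (∫⁻ p : ℝ × ℝ, F p.1 * G p.2 * S.indicator 1 p) ^ 2 ≤
      (∫⁻ ξ, F ξ ^ 2) * (∫⁻ η, G η ^ 2) * (L₁ * L₂) := by
  have hi : Measurable (S.indicator (1 : ℝ × ℝ → ℝ≥0∞)) := measurable_one.indicator hS.measurableSet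
  have h := lintegral_mul_sq_le (μ := (volume : Measure (ℝ × ℝ)))
    (f := fun p => F p.1 * S.indicator 1 p) (g := fun p => G p.2 * S.indicator 1 p)
    (by fun_prop) (by fun_prop)
  simp only [mul_pow, indicator_sq] at h
  have e1 : ∫⁻ p : ℝ × ℝ, F p.1 ^ 2 * S.indicator 1 p ≤ (∫⁻ ξ, F ξ ^ 2) * L₂ := by
    rw [Measure.volume_eq_prod, lintegral_prod _ (by fun_prop)]
    exact hS.lintegral_left_le (hF.pow_const 2)
  have e2 : ∫⁻ p : ℝ × ℝ, G p.2 ^ 2 * S.indicator 1 p ≤ (∫⁻ ξ, G ξ ^ 2) * L₁ := by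
    rw [Measure.volume_eq_prod, lintegral_prod _ (by fun_prop)]
    exact hS.lintegral_right_le (hG.pow_const 2)
  calc _ = (∫⁻ p : ℝ × ℝ, F p.1 * S.indicator 1 p * (G p.2 * S.indicator 1 p)) ^ 2 := by
        congr 1
        refine lintegral_congr fun p => ?_
        rw [mul_mul_mul_comm, ← sq, indicator_sq]
    _ ≤ _ := h
    _ ≤ (∫⁻ ξ, F ξ ^ 2) * L₂ * ((∫⁻ ξ, G ξ ^ 2) * L₁) := mul_le_mul' e1 e2
    _ = _ := by ring

end SliceBound

/-- The Fourier side of the bilinear multiplier with symbol `σ`: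
`(F, G) ↦ ∫ F(ξ) G(ζ - ξ) σ(ξ, ζ - ξ) dξ`. -/
def bilin (σ : ℝ × ℝ → ℂ) (F G : ℝ → ℂ) (ζ : ℝ) : ℂ := ∫ ξ, F ξ * G (ζ - ξ) * σ (ξ, ζ - ξ)

/-- `σ` is a measurable symbol, bounded by `c` and vanishing outside `S`. -/
structure SymbolBound (σ : ℝ × ℝ → ℂ) (c : ℝ≥0∞) (S : Set (ℝ × ℝ)) : Prop where
  measurable : Measurable σ
  le : ∀ p, ‖σ p‖ₑ ≤ c
  support : ∀ p, p ∉ S → σ p = 0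

namespace SymbolBound

variable {σ : ℝ × ℝ → ℂ} {c : ℝ≥0∞} {S : Set (ℝ × ℝ)} {L₁ L₂ : ℝ≥0∞} {F G : ℝ → ℂ}

lemma enorm_le (hσ : SymbolBound σ c S) (p : ℝ × ℝ) : ‖σ p‖ₑ ≤ c * S.indicator 1 p := by
  by_cases h : p ∈ S
  · simpa [h] using hσ.le p
  · simp [hσ.support p h]

lemma stronglyMeasurable_bilin (hσ : SymbolBound σ c S) (hF : Measurable F) (hG : Measurable G) :
    StronglyMeasurable (bilin σ F G) := by
  have h := hσ.measurable
  refine StronglyMeasurable.integral_prod_right'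
    (f := fun p : ℝ × ℝ => F p.2 * G (p.1 - p.2) * σ (p.2, p.1 - p.2)) ?_
  exact Measurable.stronglyMeasurable (by fun_prop)

lemma enorm_bilin_le (hσ : SymbolBound σ c S) (hS : SliceBound S L₁ L₂) (hF : Measurable F)
    (hG : Measurable G) (ζ : ℝ) :
    ‖bilin σ F G ζ‖ₑ ≤ c * ∫⁻ ξ, ‖F ξ‖ₑ * ‖G (ζ - ξ)‖ₑ * S.indicator 1 (ξ, ζ - ξ) := by
  have hi : Measurable (S.indicator (1 : ℝ × ℝ → ℝ≥0∞)) := measurable_one.indicator hS.measurableSet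
  refine (enorm_integral_le_lintegral_enorm _).trans ?_
  rw [← lintegral_const_mul _ (by fun_prop)]
  refine lintegral_mono fun ξ => ?_
  rw [enorm_mul, enorm_mul]
  calc _ ≤ ‖F ξ‖ₑ * ‖G (ζ - ξ)‖ₑ * (c * S.indicator 1 (ξ, ζ - ξ)) := by
        gcongr; exact hσ.enorm_le _
    _ = _ := by ring

lemma lintegral_bilin_sq_le (hσ : SymbolBound σ c S) (hS : SliceBound S L₁ L₂) (hF : Measurable F)
    (hG : Measurable G) :
    ∫⁻ ζ, ‖bilin σ F G ζ‖ₑ ^ 2 ≤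
      c ^ 2 * ((∫⁻ ξ, ‖F ξ‖ₑ ^ 2) * (∫⁻ ξ, ‖G ξ‖ₑ ^ 2) * min L₁ L₂) := by
  have hi : Measurable (S.indicator (1 : ℝ × ℝ → ℝ≥0∞)) := measurable_one.indicator hS.measurableSet
  have h1 : ∫⁻ ζ, ‖bilin σ F G ζ‖ₑ ^ 2 ≤
      c ^ 2 * ∫⁻ ζ, (∫⁻ ξ, ‖F ξ‖ₑ * ‖G (ζ - ξ)‖ₑ * S.indicator 1 (ξ, ζ - ξ)) ^ 2 := by
    rw [← lintegral_const_mul]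
    · refine lintegral_mono fun ζ => ?_
      rw [← mul_pow]
      gcongr
      exact hσ.enorm_bilin_le hS hF hG ζ
    · refine Measurable.pow_const (Measurable.lintegral_prod_right'
        (f := fun p : ℝ × ℝ => ‖F p.2‖ₑ * ‖G (p.1 - p.2)‖ₑ * S.indicator 1 (p.2, p.1 - p.2)) ?_) 2
      fun_prop
  refine h1.trans ?_
  gcongr
  rcases min_choice L₁ L₂ with h | h <;> rw [h]
  · exact hS.lintegral_sq_le_left hF.enorm hG.enorm
  · exact hS.lintegral_sq_le_right hF.enorm hG.enorm

lemma lintegral_prod_sq_le (hσ : SymbolBound σ c S) (hS : SliceBound S L₁ L₂) (hF : Measurable F)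
    (hG : Measurable G) :
    (∫⁻ p : ℝ × ℝ, ‖F p.1 * G p.2 * σ p‖ₑ) ^ 2 ≤
      c ^ 2 * ((∫⁻ ξ, ‖F ξ‖ₑ ^ 2) * (∫⁻ ξ, ‖G ξ‖ₑ ^ 2) * (L₁ * L₂)) := by
  have hi : Measurable (S.indicator (1 : ℝ × ℝ → ℝ≥0∞)) := measurable_one.indicator hS.measurableSet
  have h1 : ∫⁻ p : ℝ × ℝ, ‖F p.1 * G p.2 * σ p‖ₑ ≤
      c * ∫⁻ p : ℝ × ℝ, ‖F p.1‖ₑ * ‖G p.2‖ₑ * S.indicator 1 p := by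
    rw [← lintegral_const_mul _ (by fun_prop)]
    refine lintegral_mono fun p => ?_
    rw [enorm_mul, enorm_mul]
    calc _ ≤ ‖F p.1‖ₑ * ‖G p.2‖ₑ * (c * S.indicator 1 p) := by
          gcongr; exact hσ.enorm_le _
      _ = _ := by ring
  refine (pow_le_pow_left₀ zero_le h1 2).trans ?_
  rw [mul_pow]
  gcongr
  exact hS.lintegral_prod_sq_le hF.enorm hG.enorm

lemma lintegral_bilin_le (hσ : SymbolBound σ c S) (hF : Measurable F) (hG : Measurable G) :
    ∫⁻ ζ, ‖bilin σ F G ζ‖ₑ ≤ ∫⁻ p : ℝ × ℝ, ‖F p.1 * G p.2 * σ p‖ₑ := by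
  have hm := hσ.measurable
  calc _ ≤ ∫⁻ ζ, ∫⁻ ξ, ‖F ξ * G (ζ - ξ) * σ (ξ, ζ - ξ)‖ₑ :=
        lintegral_mono fun ζ => enorm_integral_le_lintegral_enorm _
    _ = ∫⁻ ξ, ∫⁻ η, ‖F ξ * G η * σ (ξ, η)‖ₑ :=
        lintegral_shear (h := fun p => ‖F p.1 * G p.2 * σ p‖ₑ) (by fun_prop)
    _ = _ := by
        rw [Measure.volume_eq_prod, lintegral_prod _ (by fun_prop)]

end SymbolBound

/-- Measurable bounded symbols with support in a set of bounded slices. -/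
def AdmissibleSymbol (σ : ℝ × ℝ → ℂ) : Prop :=
  ∃ (c : ℝ≥0∞) (S : Set (ℝ × ℝ)) (L₁ L₂ : ℝ≥0∞), c ≠ ⊤ ∧ L₁ ≠ ⊤ ∧ L₂ ≠ ⊤ ∧
    SymbolBound σ c S ∧ SliceBound S L₁ L₂

lemma sliceBound_of_subset_box {S : Set (ℝ × ℝ)} (hS : MeasurableSet S) {R : ℝ}
    (h : ∀ p ∈ S, |p.1| ≤ R ∧ |p.2| ≤ R) :
    SliceBound S (ENNReal.ofReal (2 * R)) (ENNReal.ofReal (2 * R)) := by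
  have hv : volume (Icc (-R) R) = ENNReal.ofReal (2 * R) := by
    rw [Real.volume_Icc]; congr 1; ring
  refine ⟨hS, fun η => ?_, fun ξ => ?_⟩ <;> rw [← hv] <;> refine measure_mono fun x hx => ?_
  · exact abs_le.1 (h _ hx).1
  · exact abs_le.1 (h _ hx).2

lemma admissibleSymbol_of_bound {σ : ℝ × ℝ → ℂ} (hm : Measurable σ) {M R : ℝ}
    (hM : ∀ p, ‖σ p‖ ≤ M) (hR : ∀ p, σ p ≠ 0 → |p.1| ≤ R ∧ |p.2| ≤ R) : AdmissibleSymbol σ := by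
  refine ⟨ENNReal.ofReal M, {p | |p.1| ≤ R ∧ |p.2| ≤ R}, _, _, ENNReal.ofReal_ne_top,
    ENNReal.ofReal_ne_top, ENNReal.ofReal_ne_top, ⟨hm, fun p => ?_, fun p hp => ?_⟩,
    sliceBound_of_subset_box ?_ fun p hp => hp⟩
  · rw [← ofReal_norm]; exact ENNReal.ofReal_le_ofReal (hM p)
  · by_contra h; exact hp (hR p h)
  · have h1 : MeasurableSet {p : ℝ × ℝ | |p.1| ≤ R} := measurableSet_le (by fun_prop) (by fun_prop)
    have h2 : MeasurableSet {p : ℝ × ℝ | |p.2| ≤ R} := measurableSet_le (by fun_prop) (by fun_prop)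
    exact h1.inter h2

namespace AdmissibleSymbol

variable {σ σ' : ℝ × ℝ → ℂ} {f g : L2}

lemma measurable (hσ : AdmissibleSymbol σ) : Measurable σ := by
  obtain ⟨c, S, L₁, L₂, -, -, -, h, -⟩ := hσ
  exact h.measurable

lemma integrable_prod (hσ : AdmissibleSymbol σ) (f g : L2) :
    Integrable fun p : ℝ × ℝ => hatL2 f p.1 * hatL2 g p.2 * σ p := by
  obtain ⟨c, S, L₁, L₂, hc, h1, h2, h, hS⟩ := hσ
  have hF := measurable_hatL2 f
  have hG := measurable_hatL2 g
  have hm := h.measurable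
  refine ⟨(by fun_prop : Measurable _).aestronglyMeasurable, ?_⟩
  have h3 := h.lintegral_prod_sq_le hS hF hG
  rw [lintegral_hatL2_sq, lintegral_hatL2_sq] at h3
  have h4 : c ^ 2 * (‖f‖ₑ ^ 2 * ‖g‖ₑ ^ 2 * (L₁ * L₂)) < ⊤ := by
    have : ‖f‖ₑ < ⊤ := enorm_lt_top
    have : ‖g‖ₑ < ⊤ := enorm_lt_top
    finiteness
  exact (ENNReal.pow_lt_top_iff (n := 2)).1 (h3.trans_lt h4) |>.resolve_right two_ne_zero

lemma memLp_bilin (hσ : AdmissibleSymbol σ) (f g : L2) :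
    MemLp (bilin σ (hatL2 f) (hatL2 g)) 2 volume := by
  obtain ⟨c, S, L₁, L₂, hc, h1, h2, h, hS⟩ := hσ
  have hF := measurable_hatL2 f
  have hG := measurable_hatL2 g
  refine ⟨(h.stronglyMeasurable_bilin hF hG).aestronglyMeasurable, ?_⟩
  have h3 := h.lintegral_bilin_sq_le hS hF hG
  rw [lintegral_hatL2_sq, lintegral_hatL2_sq, ← eLpNorm_two_sq_eq_lintegral] at h3
  have h4 : c ^ 2 * (‖f‖ₑ ^ 2 * ‖g‖ₑ ^ 2 * (min L₁ L₂)) < ⊤ := by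
    have : ‖f‖ₑ < ⊤ := enorm_lt_top
    have : ‖g‖ₑ < ⊤ := enorm_lt_top
    have : min L₁ L₂ < ⊤ := (min_le_left _ _).trans_lt (lt_top_iff_ne_top.2 h1)
    finiteness
  exact (ENNReal.pow_lt_top_iff (n := 2)).1 (h3.trans_lt h4) |>.resolve_right two_ne_zero

lemma integrable_bilin (hσ : AdmissibleSymbol σ) (f g : L2) :
    Integrable (bilin σ (hatL2 f) (hatL2 g)) := by
  have hi := hσ.integrable_prod f g
  have hme := (hσ.memLp_bilin f g).1
  obtain ⟨c, S, L₁, L₂, hc, h1, h2, h, hS⟩ := hσ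
  exact ⟨hme, (h.lintegral_bilin_le (measurable_hatL2 f) (measurable_hatL2 g)).trans_lt hi.2⟩

lemma integrable_shear (hσ : AdmissibleSymbol σ) (f g : L2) :
    Integrable fun p : ℝ × ℝ => hatL2 f p.2 * hatL2 g (p.1 - p.2) * σ (p.2, p.1 - p.2) := by
  have h := (hσ.integrable_prod f g).swap
  exact (measurePreserving_sub_prod (volume : Measure ℝ) (volume : Measure ℝ)).integrable_comp_of_integrable h

lemma ae_integrable (hσ : AdmissibleSymbol σ) (f g : L2) :
    ∀ᵐ ζ : ℝ, Integrable fun ξ => hatL2 f ξ * hatL2 g (ζ - ξ) * σ (ξ, ζ - ξ) :=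
  (hσ.integrable_shear f g).prod_right_ae

lemma bilin_add (hσ : AdmissibleSymbol σ) (hσ' : AdmissibleSymbol σ') (f g : L2) :
    bilin (fun p => σ p + σ' p) (hatL2 f) (hatL2 g) =ᵐ[volume]
      fun ζ => bilin σ (hatL2 f) (hatL2 g) ζ + bilin σ' (hatL2 f) (hatL2 g) ζ := by
  filter_upwards [hσ.ae_integrable f g, hσ'.ae_integrable f g] with ζ h h'
  rw [bilin, bilin, bilin, ← integral_add h h']
  refine integral_congr_ae (Eventually.of_forall fun ξ => ?_)
  simp only; ring

/-- Pairing with a function of the total frequency. -/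
lemma integral_bilin_mul (hσ : AdmissibleSymbol σ) (f g : L2) {k : ℝ → ℂ} (hk : Measurable k)
    {K : ℝ} (hK : ∀ ζ, ‖k ζ‖ ≤ K) :
    ∫ ζ, bilin σ (hatL2 f) (hatL2 g) ζ * k ζ =
      ∫ p : ℝ × ℝ, hatL2 f p.1 * hatL2 g p.2 * σ p * k (p.1 + p.2) := by
  have hi : Integrable fun p : ℝ × ℝ => hatL2 f p.1 * hatL2 g p.2 * σ p * k (p.1 + p.2) :=
    (hσ.integrable_prod f g).mul_bdd
      (hk.comp (by fun_prop : Measurable fun p : ℝ × ℝ => p.1 + p.2)).aestronglyMeasurable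
      (Eventually.of_forall fun p => hK _)
  have hj := (measurePreserving_sub_prod (volume : Measure ℝ) (volume : Measure ℝ)).integrable_comp_of_integrable hi.swap
  have e1 : ∀ ζ, bilin σ (hatL2 f) (hatL2 g) ζ * k ζ =
      ∫ ξ, hatL2 f ξ * hatL2 g (ζ - ξ) * σ (ξ, ζ - ξ) * k (ξ + (ζ - ξ)) := by
    intro ζ
    rw [bilin, ← integral_mul_const]
    simp
  simp_rw [e1]
  rw [integral_integral_swap (f := fun ζ ξ =>
    hatL2 f ξ * hatL2 g (ζ - ξ) * σ (ξ, ζ - ξ) * k (ξ + (ζ - ξ))) hj,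
    Measure.volume_eq_prod, integral_prod _ hi]
  refine integral_congr_ae (Eventually.of_forall fun ξ => ?_)
  exact integral_sub_right_eq_self
    (fun η => hatL2 f ξ * hatL2 g η * σ (ξ, η) * k (ξ + η)) ξ

end AdmissibleSymbol

/-! ### `L^q` bounds -/

lemma recip_nonneg (q : ℝ≥0∞) : 0 ≤ recip q := ENNReal.toReal_nonneg

lemma recip_le_half {q : ℝ≥0∞} (hq : 2 ≤ q) : recip q ≤ 1 / 2 := by
  have h : q⁻¹ ≤ 2⁻¹ := ENNReal.inv_le_inv.2 hq
  have := ENNReal.toReal_mono (by simp) h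
  simpa [recip] using this

lemma recip_top : recip ⊤ = 0 := by simp [recip]

lemma recip_pos {q : ℝ≥0∞} (hq : 2 ≤ q) (hq' : q ≠ ⊤) : 0 < recip q := by
  refine ENNReal.toReal_pos (by simpa using hq') ?_
  exact ENNReal.inv_ne_top.2 (by rintro rfl; simp at hq)

/-- Interpolation between `L²` and `L^∞`. -/
lemma eLpNorm_le_two_top {q : ℝ≥0∞} (hq : 2 ≤ q) {u : ℝ → ℂ} (hu : AEStronglyMeasurable u volume) :
    eLpNorm u q volume ≤
      eLpNorm u 2 volume ^ (2 * recip q) * eLpNorm u ⊤ volume ^ (1 - 2 * recip q) := by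
  rcases eq_or_ne q ⊤ with rfl | hq'
  · simp [recip_top]
  have hr := recip_pos hq hq'
  have hr' := recip_le_half hq
  have hq0 : q ≠ 0 := by rintro rfl; simp at hq
  have hqr : recip q = 1 / q.toReal := by simp [recip]
  have hqpos : 0 < q.toReal := ENNReal.toReal_pos hq0 hq'
  have hq2 : 2 ≤ q.toReal := by
    have := ENNReal.toReal_mono hq' hq
    simpa using this
  rw [eLpNorm_eq_lintegral_rpow_enorm_toReal hq0 hq']
  -- Pointwise, `|u|^q = |u|^{q-2} |u|²`, and the first factor is at most its essential supremum.
  have h1 : ∫⁻ x, ‖u x‖ₑ ^ q.toReal ≤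
      eLpNorm u ⊤ volume ^ (q.toReal - 2) * eLpNorm u 2 volume ^ 2 := by
    rw [eLpNorm_two_sq_eq_lintegral]
    rw [← lintegral_const_mul'' _ (by fun_prop)]
    refine lintegral_mono_ae ?_
    filter_upwards [ae_le_eLpNormEssSup (f := u) (μ := volume)] with x hx
    rw [eLpNorm_exponent_top]
    calc ‖u x‖ₑ ^ q.toReal = ‖u x‖ₑ ^ (q.toReal - 2) * ‖u x‖ₑ ^ 2 := by
          rw [← ENNReal.rpow_ofNat, ← ENNReal.rpow_add_of_nonneg _ _ (by linarith) (by norm_num)]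
          congr 1; ring
      _ ≤ _ := by gcongr
  calc _ ≤ (eLpNorm u ⊤ volume ^ (q.toReal - 2) * eLpNorm u 2 volume ^ 2) ^ (1 / q.toReal) := by
        gcongr
    _ = _ := by
        rw [ENNReal.mul_rpow_of_nonneg _ _ (by positivity), ← ENNReal.rpow_mul,
          ← ENNReal.rpow_ofNat, ← ENNReal.rpow_mul, mul_comm, hqr]
        congr 2
        field_simp

/-- The endpoint `L¹ → L^∞` of Hausdorff–Young; its constant `(2π)^{-1/2}` is at most `1` and is
dropped. -/
lemma eLpNorm_top_le_lintegral {u : L2} {B : ℝ → ℂ} (hu : hatL2 u =ᵐ[volume] B)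
    (hB : Integrable B volume) : eLpNorm u ⊤ volume ≤ ∫⁻ ξ, ‖B ξ‖ₑ := by
  rw [eLpNorm_congr_ae (ae_eq_invHat_of_hatL2_eq hu hB), eLpNorm_exponent_top]
  refine eLpNormEssSup_le_of_ae_enorm_bound (Eventually.of_forall fun x => ?_)
  have h1 : ‖(((Real.sqrt (2 * Real.pi))⁻¹ : ℝ) : ℂ)‖ₑ ≤ 1 := by
    rw [← ofReal_norm, Complex.norm_real, Real.norm_of_nonneg (by positivity)]
    rw [ENNReal.ofReal_le_one]
    refine inv_le_one_of_one_le₀ (Real.one_le_sqrt.2 ?_)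
    linarith [Real.pi_gt_three]
  rw [invHat, enorm_mul]
  calc _ ≤ 1 * ∫⁻ ξ, ‖Complex.exp (Complex.I * ((x * ξ : ℝ) : ℂ)) * B ξ‖ₑ := by
        gcongr; exact enorm_integral_le_lintegral_enorm _
    _ = _ := by
        rw [one_mul]
        refine lintegral_congr fun ξ => ?_
        rw [enorm_mul, ← ofReal_norm, Complex.norm_exp_I_mul_ofReal]; simp

/-- The bilinear multiplier with symbol `σ` is bounded from `L² × L²` to `L^q` by `A`. -/
def MultiplierBound (q : ℝ≥0∞) (σ : ℝ × ℝ → ℂ) (A : ℝ) : Prop :=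
  ∀ f g u : L2, hatL2 u =ᵐ[volume] bilin σ (hatL2 f) (hatL2 g) →
    eLpNorm u q volume ≤ ENNReal.ofReal A * ‖f‖ₑ * ‖g‖ₑ

lemma MultiplierBound.mono {q : ℝ≥0∞} {σ : ℝ × ℝ → ℂ} {A A' : ℝ} (h : MultiplierBound q σ A)
    (hA : A ≤ A') : MultiplierBound q σ A' := fun f g u hu =>
  (h f g u hu).trans (by gcongr)

/-- Admissibility ensures that each summand has an `L²` output of its own. Injectivity of the
transform identifies `u` with the sum of these outputs, and the triangle inequality in `L^q`
concludes. -/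
lemma MultiplierBound.add {q : ℝ≥0∞} (hq : 2 ≤ q) {σ σ' : ℝ × ℝ → ℂ} {A A' : ℝ} (hA : 0 ≤ A)
    (hA' : 0 ≤ A') (h : MultiplierBound q σ A) (h' : MultiplierBound q σ' A')
    (hσ : AdmissibleSymbol σ) (hσ' : AdmissibleSymbol σ') :
    MultiplierBound q (fun p => σ p + σ' p) (A + A') := by
  intro f g u hu
  obtain ⟨v, hv⟩ := exists_hatL2_eq (hσ.memLp_bilin f g)
  obtain ⟨w, hw⟩ := exists_hatL2_eq (hσ'.memLp_bilin f g)
  have huvw : u = v + w := by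
    refine hatL2_injective ?_
    filter_upwards [hu, hv, hw, hσ.bilin_add hσ' f g, hatL2_add v w] with ζ h1 h2 h3 h4 h5
    rw [h1, h4, h5, h2, h3]
  have e : eLpNorm u q volume = eLpNorm (v + w : ℝ → ℂ) q volume := by
    rw [huvw]; exact eLpNorm_congr_ae (Lp.coeFn_add v w)
  rw [e]
  refine (eLpNorm_add_le (Lp.aestronglyMeasurable v) (Lp.aestronglyMeasurable w)
    (le_trans (by norm_num) hq)).trans ?_
  refine (add_le_add (h f g v hv) (h' f g w hw)).trans_eq ?_
  rw [ENNReal.ofReal_add hA hA']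
  ring

/-- The core estimate. At `q = 2` it is Plancherel with the better of the two one-sided
Cauchy–Schwarz bounds. At `q = ∞` the output is controlled by the `L¹` norm of its transform, hence
by an integral over the plane. Interpolation with weights `2/q` and `1 - 2/q` gives the exponents
`1/q` and `1/2 - 1/q`. -/
lemma SymbolBound.multiplierBound {q : ℝ≥0∞} (hq : 2 ≤ q) {σ : ℝ × ℝ → ℂ} {S : Set (ℝ × ℝ)}
    {c l₁ l₂ : ℝ} (hc : 0 ≤ c) (h₁ : 0 ≤ l₁) (h₂ : 0 ≤ l₂)
    (hσ : SymbolBound σ (ENNReal.ofReal c) S)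
    (hS : SliceBound S (ENNReal.ofReal l₁) (ENNReal.ofReal l₂)) :
    MultiplierBound q σ (c * (min l₁ l₂ ^ recip q * (l₁ * l₂) ^ (1 / 2 - recip q))) := by
  intro f g u hu
  have hr := recip_nonneg q
  have hr' := recip_le_half hq
  have hadm : AdmissibleSymbol σ := ⟨_, _, _, _, ENNReal.ofReal_ne_top, ENNReal.ofReal_ne_top,
    ENNReal.ofReal_ne_top, hσ, hS⟩
  set X := ENNReal.ofReal c * ‖f‖ₑ * ‖g‖ₑ with hX
  have hsq : ∀ y z : ℝ≥0∞, y ^ 2 ≤ z → y ≤ z ^ (1 / 2 : ℝ) := by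
    intro y z h
    have := ENNReal.rpow_le_rpow h (z := 1 / 2) (by norm_num)
    rwa [← ENNReal.rpow_natCast, ← ENNReal.rpow_mul, show ((2 : ℕ) : ℝ) * (1 / 2) = 1 by norm_num,
      ENNReal.rpow_one] at this
  have hpow : ∀ y : ℝ≥0∞, (X ^ 2 * y) ^ (1 / 2 : ℝ) = X * y ^ (1 / 2 : ℝ) := by
    intro y
    rw [ENNReal.mul_rpow_of_nonneg _ _ (by norm_num), ← ENNReal.rpow_natCast, ← ENNReal.rpow_mul,
      show ((2 : ℕ) : ℝ) * (1 / 2) = 1 by norm_num, ENNReal.rpow_one]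
  have h2 : eLpNorm u 2 volume ≤ X * ENNReal.ofReal (min l₁ l₂) ^ (1 / 2 : ℝ) := by
    rw [← hpow]
    refine hsq _ _ ?_
    have h3 := hσ.lintegral_bilin_sq_le hS (measurable_hatL2 f) (measurable_hatL2 g)
    have h4 : eLpNorm u 2 volume = eLpNorm (hatL2 u) 2 volume := by
      rw [eLpNorm_hatL2, Lp.enorm_def]
    rw [h4, eLpNorm_congr_ae hu, eLpNorm_two_sq_eq_lintegral]
    refine h3.trans_eq ?_
    rw [lintegral_hatL2_sq, lintegral_hatL2_sq, ENNReal.ofReal_min]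
    ring
  have ht : eLpNorm u ⊤ volume ≤ X * ENNReal.ofReal (l₁ * l₂) ^ (1 / 2 : ℝ) := by
    rw [← hpow]
    refine hsq _ _ ?_
    have h3 := hσ.lintegral_prod_sq_le hS (measurable_hatL2 f) (measurable_hatL2 g)
    have h4 := (eLpNorm_top_le_lintegral hu (hadm.integrable_bilin f g)).trans
      (hσ.lintegral_bilin_le (measurable_hatL2 f) (measurable_hatL2 g))
    refine (pow_le_pow_left₀ zero_le h4 2).trans (h3.trans_eq ?_)
    rw [lintegral_hatL2_sq, lintegral_hatL2_sq, ENNReal.ofReal_mul h₁]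
    ring
  refine (eLpNorm_le_two_top hq (Lp.aestronglyMeasurable u)).trans ?_
  clear_value X
  calc _ ≤ (X * ENNReal.ofReal (min l₁ l₂) ^ (1 / 2 : ℝ)) ^ (2 * recip q) *
        (X * ENNReal.ofReal (l₁ * l₂) ^ (1 / 2 : ℝ)) ^ (1 - 2 * recip q) := by
        gcongr; linarith
    _ = (X ^ (2 * recip q) * X ^ (1 - 2 * recip q)) *
        (ENNReal.ofReal (min l₁ l₂) ^ recip q * ENNReal.ofReal (l₁ * l₂) ^ (1 / 2 - recip q)) := by
        rw [ENNReal.mul_rpow_of_nonneg _ _ (by linarith), ENNReal.mul_rpow_of_nonneg _ _ (by linarith),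
          ← ENNReal.rpow_mul, ← ENNReal.rpow_mul]
        rw [show 1 / 2 * (2 * recip q) = recip q by ring,
          show 1 / 2 * (1 - 2 * recip q) = 1 / 2 - recip q by ring]
        ring
    _ = _ := by
        rw [← ENNReal.rpow_add_of_nonneg _ _ (by linarith) (by linarith),
          add_sub_cancel, ENNReal.rpow_one, ENNReal.ofReal_rpow_of_nonneg (le_min h₁ h₂) hr,
          ENNReal.ofReal_rpow_of_nonneg (mul_nonneg h₁ h₂) (by linarith),
          ← ENNReal.ofReal_mul (by positivity), ENNReal.ofReal_mul hc, hX]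
        ring

/-! ### Dyadic decomposition with respect to the size of the phase -/

/-- Near `P`, the horizontal and vertical slices of `{|φ| ≤ δ}` have lengths `O(δ ^ p)` and
`O(δ ^ r)`. -/
def LocalSublevel (φ : ℝ × ℝ → ℝ) (p r : ℝ) (P : ℝ × ℝ) : Prop :=
  ∃ U : Set (ℝ × ℝ), IsOpen U ∧ P ∈ U ∧ (∃ R : ℝ, ∀ x ∈ U, |x.1| ≤ R ∧ |x.2| ≤ R) ∧
    ∃ C : ℝ, 0 ≤ C ∧ ∀ δ : ℝ, 0 < δ → δ ≤ 1 →
      SliceBound {x | x ∈ U ∧ |φ x| ≤ δ} (ENNReal.ofReal (C * δ ^ p)) (ENNReal.ofReal (C * δ ^ r))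

/-- The power of `δ` in the `L² × L² → L^q` bound for the indicator of a set with slices of lengths
`δ ^ p` and `δ ^ r`. -/
def sublevelExponent (q : ℝ≥0∞) (p r : ℝ) : ℝ :=
  max p r * recip q + (p + r) * (1 / 2 - recip q)

lemma sublevelExponent_comm (q : ℝ≥0∞) (p r : ℝ) :
    sublevelExponent q p r = sublevelExponent q r p := by
  rw [sublevelExponent, sublevelExponent, max_comm, add_comm p r]

/-- Symbols supported in a neighbourhood of `A` and of size `min (2 ^ J) (1 / |φ|)` are bounded
from `L² × L²` to `L^q` by a geometric sum. -/
def DyadicBound (q : ℝ≥0∞) (φ : ℝ × ℝ → ℝ) (M κ : ℝ) (A : Set (ℝ × ℝ)) : Prop :=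
  ∃ A' : Set (ℝ × ℝ), A ⊆ A' ∧ MeasurableSet A' ∧ (∃ R : ℝ, ∀ x ∈ A', |x.1| ≤ R ∧ |x.2| ≤ R) ∧
    ∃ C : ℝ, 0 ≤ C ∧ ∀ (J : ℕ) (σ : ℝ × ℝ → ℂ), Measurable σ → (∀ x, ‖σ x‖ ≤ M * 2 ^ J) →
      (∀ x, ‖σ x‖ * |φ x| ≤ M) → (∀ x, x ∉ A' → σ x = 0) →
      MultiplierBound q σ (C * (1 + ∑ j ∈ Finset.range J, ((2 : ℝ) ^ (1 - κ)) ^ j))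

lemma one_add_geom_nonneg (κ : ℝ) (J : ℕ) :
    0 ≤ 1 + ∑ j ∈ Finset.range J, ((2 : ℝ) ^ (1 - κ)) ^ j :=
  add_nonneg zero_le_one (Finset.sum_nonneg fun _ _ => by positivity)

lemma symbolBound_ofReal {σ : ℝ × ℝ → ℂ} (hm : Measurable σ) {c : ℝ} {S : Set (ℝ × ℝ)}
    (hc : ∀ x, ‖σ x‖ ≤ c) (hS : ∀ x, x ∉ S → σ x = 0) : SymbolBound σ (ENNReal.ofReal c) S :=
  ⟨hm, fun x => by rw [← ofReal_norm]; exact ENNReal.ofReal_le_ofReal (hc x), hS⟩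

/-- A crude bound for symbols of bounded support. -/
lemma multiplierBound_of_box {q : ℝ≥0∞} (hq : 2 ≤ q) {A : Set (ℝ × ℝ)} (hA : MeasurableSet A)
    {R : ℝ} (hR : ∀ x ∈ A, |x.1| ≤ R ∧ |x.2| ≤ R) :
    ∃ C : ℝ, 0 ≤ C ∧ ∀ (c : ℝ) (σ : ℝ × ℝ → ℂ), 0 ≤ c → Measurable σ → (∀ x, ‖σ x‖ ≤ c) →
      (∀ x, x ∉ A → σ x = 0) → MultiplierBound q σ (C * c) := by
  have h := sliceBound_of_subset_box hA (R := max R 0)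
    (fun x hx => ⟨(hR x hx).1.trans (le_max_left _ _), (hR x hx).2.trans (le_max_left _ _)⟩)
  have h0 : 0 ≤ 2 * max R 0 := by positivity
  refine ⟨min (2 * max R 0) (2 * max R 0) ^ recip q *
    (2 * max R 0 * (2 * max R 0)) ^ (1 / 2 - recip q), ?_, fun c σ hc hm hσ hs => ?_⟩
  · positivity
  · rw [mul_comm]
    exact SymbolBound.multiplierBound hq hc h0 h0 (symbolBound_ofReal hm hσ hs) h

/-- Restriction of a symbol to a set. -/
lemma indicator_add_compl_symbol (σ : ℝ × ℝ → ℂ) (E : Set (ℝ × ℝ)) :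
    σ = fun x => E.indicator σ x + Eᶜ.indicator σ x := by
  ext x
  by_cases h : x ∈ E <;> simp [h]

lemma norm_indicator_symbol_le (σ : ℝ × ℝ → ℂ) (E : Set (ℝ × ℝ)) (x : ℝ × ℝ) :
    ‖E.indicator σ x‖ ≤ ‖σ x‖ := norm_indicator_le_norm_self _ _

lemma indicator_symbol_eq_zero {σ : ℝ × ℝ → ℂ} {A E : Set (ℝ × ℝ)}
    (h : ∀ x, x ∉ A → σ x = 0) (x : ℝ × ℝ) (hx : x ∉ A) : E.indicator σ x = 0 := by
  by_cases hE : x ∈ E <;> simp [hE, h x hx]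

/-- Induction on `J` peels off one layer at a time. Off `{|φ| ≤ 2^{-J}}` the bound `|σ||φ| ≤ M`
forces `|σ| ≤ M 2^J`, so that part satisfies the hypotheses at level `J`. On the sublevel set `|σ| ≤
M 2^{J+1}`, and the slice lengths give a contribution of order `2^J 2^{-Jκ}`. -/
lemma dyadicBound_of_localSublevel {q : ℝ≥0∞} (hq : 2 ≤ q) {φ : ℝ × ℝ → ℝ} (hφ : Measurable φ)
    {M : ℝ} (hM : 0 ≤ M) {p r : ℝ} {P : ℝ × ℝ} (h : LocalSublevel φ p r P) :
    ∃ U ∈ 𝓝 P, DyadicBound q φ M (sublevelExponent q p r) U := by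
  obtain ⟨U, hU, hP, ⟨R, hR⟩, C, hC, hs⟩ := h
  obtain ⟨K, hK, hbox⟩ := multiplierBound_of_box hq hU.measurableSet hR
  refine ⟨U, hU.mem_nhds hP, U, subset_rfl, hU.measurableSet, ⟨R, hR⟩, ?_⟩
  set θ := recip q with hθ
  have hθ0 := recip_nonneg q
  have hθ1 := recip_le_half hq
  set κ := sublevelExponent q p r with hκ
  -- The first summand pays for the base case and the second for one layer, its factor `2` coming
  -- from `2^{J+1} = 2 · 2^J`.
  set D : ℝ := K * M + 2 * M * (C ^ θ * (C * C) ^ (1 / 2 - θ)) with hD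
  have hD0 : 0 ≤ 2 * M * (C ^ θ * (C * C) ^ (1 / 2 - θ)) := by positivity
  have hKM : 0 ≤ K * M := by positivity
  refine ⟨D, by positivity, fun J => ?_⟩
  induction J with
  | zero =>
    intro σ hm h1 h2 h3
    refine (hbox M σ hM hm (fun x => by simpa using h1 x) h3).mono ?_
    rw [Finset.range_zero, Finset.sum_empty, add_zero, mul_one, hD]
    linarith
  | succ J ih =>
    intro σ hm h1 h2 h3
    set δ : ℝ := (2 ^ J)⁻¹ with hδ
    have hδ0 : 0 < δ := by positivity
    have hδ1 : δ ≤ 1 := inv_le_one_of_one_le₀ (one_le_pow₀ (by norm_num))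
    set E : Set (ℝ × ℝ) := {x | |φ x| ≤ δ} with hE
    have hEm : MeasurableSet E := measurableSet_le (by fun_prop) (by fun_prop)
    have b1 : MultiplierBound q (Eᶜ.indicator σ)
        (D * (1 + ∑ j ∈ Finset.range J, ((2 : ℝ) ^ (1 - κ)) ^ j)) := by
      refine ih _ (hm.indicator hEm.compl) (fun x => ?_) (fun x => ?_)
        (indicator_symbol_eq_zero h3)
      · by_cases hx : x ∈ Eᶜ
        · have hx' : δ < |φ x| := not_le.1 hx
          rw [indicator_of_mem hx]
          have := (mul_le_mul_of_nonneg_left hx'.le (norm_nonneg (σ x))).trans (h2 x)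
          rwa [hδ, ← div_eq_mul_inv, div_le_iff₀ (by positivity)] at this
        · rw [indicator_of_notMem hx, norm_zero]; positivity
      · exact (mul_le_mul_of_nonneg_right (norm_indicator_symbol_le σ _ x) (abs_nonneg _)).trans
          (h2 x)
    have b2 : MultiplierBound q (E.indicator σ) (D * ((2 : ℝ) ^ (1 - κ)) ^ J) := by
      have hsb : SymbolBound (E.indicator σ) (ENNReal.ofReal (M * 2 ^ (J + 1)))
          {x | x ∈ U ∧ |φ x| ≤ δ} := by
        refine symbolBound_ofReal (hm.indicator hEm)
          (fun x => (norm_indicator_symbol_le σ _ x).trans (h1 x)) (fun x hx => ?_)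
        by_cases hxU : x ∈ U
        · exact indicator_of_notMem (s := E) (fun hxE => hx ⟨hxU, hxE⟩) _
        · exact indicator_symbol_eq_zero h3 x hxU
      have hb := hsb.multiplierBound hq (by positivity) (by positivity) (by positivity)
        (hs δ hδ0 hδ1)
      refine hb.mono ?_
      have e1 : min (C * δ ^ p) (C * δ ^ r) ≤ C * δ ^ max p r := by
        rcases max_choice p r with hmx | hmx <;> rw [hmx]
        · exact min_le_left _ _
        · exact min_le_right _ _
      have e2 : C * δ ^ p * (C * δ ^ r) = (C * C) * δ ^ (p + r) := by
        rw [Real.rpow_add hδ0]; ring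
      -- With `δ = 2^{-J}`, the gain `δ^κ` against the size `2^J` is exactly the `J`-th term of the
      -- geometric sum.
      have e3 : δ ^ κ * 2 ^ J = ((2 : ℝ) ^ (1 - κ)) ^ J := by
        rw [hδ, Real.inv_rpow (by positivity), ← Real.rpow_natCast, ← Real.rpow_mul (by norm_num),
          ← Real.rpow_neg (by norm_num), ← Real.rpow_add (by norm_num), ← Real.rpow_natCast,
          ← Real.rpow_mul (by norm_num)]
        congr 1; ring
      calc _ ≤ M * 2 ^ (J + 1) * ((C * δ ^ max p r) ^ θ * ((C * C) * δ ^ (p + r)) ^ (1 / 2 - θ)) := by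
            rw [e2]
            gcongr
        _ = M * 2 ^ (J + 1) * (C ^ θ * (C * C) ^ (1 / 2 - θ)) * δ ^ κ := by
            rw [Real.mul_rpow hC (by positivity), Real.mul_rpow (by positivity) (by positivity),
              ← Real.rpow_mul hδ0.le, ← Real.rpow_mul hδ0.le, hκ, sublevelExponent,
              Real.rpow_add hδ0]
            ring
        _ = 2 * M * (C ^ θ * (C * C) ^ (1 / 2 - θ)) * ((2 : ℝ) ^ (1 - κ)) ^ J := by
            rw [← e3]; ring
        _ ≤ _ := by
            rw [hD]; gcongr; linarith
    have hadd := MultiplierBound.add hq (mul_nonneg (by positivity) (by positivity))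
      (mul_nonneg (by positivity) (one_add_geom_nonneg κ J)) b2 b1
      (admissibleSymbol_of_bound (hm.indicator hEm)
        (fun x => (norm_indicator_symbol_le σ _ x).trans (h1 x))
        (fun x hx => hR x (by by_contra hxU; exact hx (indicator_symbol_eq_zero h3 x hxU))))
      (admissibleSymbol_of_bound (hm.indicator hEm.compl)
        (fun x => (norm_indicator_symbol_le σ _ x).trans (h1 x))
        (fun x hx => hR x (by by_contra hxU; exact hx (indicator_symbol_eq_zero h3 x hxU))))
    rw [← indicator_add_compl_symbol σ E] at hadd
    refine hadd.mono (le_of_eq ?_)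
    rw [Finset.sum_range_succ]; ring

/-- The class of symbols is stable under multiplication by indicators, so sharp cutoffs serve in
place of a partition of unity. -/
lemma dyadicBound_union {q : ℝ≥0∞} (hq : 2 ≤ q) {φ : ℝ × ℝ → ℝ} {M κ : ℝ}
    {A B : Set (ℝ × ℝ)} (hA : DyadicBound q φ M κ A) (hB : DyadicBound q φ M κ B) :
    DyadicBound q φ M κ (A ∪ B) := by
  obtain ⟨A', hAA, hAm, ⟨R, hR⟩, C, hC, h⟩ := hA
  obtain ⟨B', hBB, hBm, ⟨R', hR'⟩, C', hC', h'⟩ := hB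
  refine ⟨A' ∪ B', union_subset_union hAA hBB, hAm.union hBm, ⟨max R R', fun x hx => ?_⟩, C + C',
    add_nonneg hC hC', fun J σ hm h1 h2 h3 => ?_⟩
  · rcases hx with hx | hx
    · exact ⟨(hR x hx).1.trans (le_max_left _ _), (hR x hx).2.trans (le_max_left _ _)⟩
    · exact ⟨(hR' x hx).1.trans (le_max_right _ _), (hR' x hx).2.trans (le_max_right _ _)⟩
  have s1 : ∀ x, x ∉ A' → A'.indicator σ x = 0 := fun x hx => indicator_of_notMem hx _
  have s2 : ∀ x, x ∉ B' → A'ᶜ.indicator σ x = 0 := by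
    intro x hx
    by_cases hxA : x ∈ A'
    · exact indicator_of_notMem (by simpa using hxA) _
    · rw [indicator_of_mem (by simpa using hxA)]
      exact h3 x (by simp [hx, hxA])
  have n1 := fun x => (norm_indicator_symbol_le σ A' x).trans (h1 x)
  have n2 := fun x => (norm_indicator_symbol_le σ A'ᶜ x).trans (h1 x)
  have b1 := h J _ (hm.indicator hAm) n1 (fun x =>
    (mul_le_mul_of_nonneg_right (norm_indicator_symbol_le σ _ x) (abs_nonneg _)).trans (h2 x)) s1
  have b2 := h' J _ (hm.indicator hAm.compl) n2 (fun x =>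
    (mul_le_mul_of_nonneg_right (norm_indicator_symbol_le σ _ x) (abs_nonneg _)).trans (h2 x)) s2
  have hadd := MultiplierBound.add hq (mul_nonneg hC (one_add_geom_nonneg κ J))
    (mul_nonneg hC' (one_add_geom_nonneg κ J)) b1 b2
    (admissibleSymbol_of_bound (hm.indicator hAm) n1
      (fun x hx => hR x (by by_contra hxU; exact hx (s1 x hxU))))
    (admissibleSymbol_of_bound (hm.indicator hAm.compl) n2
      (fun x hx => hR' x (by by_contra hxU; exact hx (s2 x hxU))))
  rw [← indicator_add_compl_symbol σ A'] at hadd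
  exact hadd.mono (le_of_eq (add_mul _ _ _).symm)

/-- The exponent is symmetric in `p` and `r`, so the roles of the two axes may be exchanged from one
point to another without affecting the finite covering argument. -/
lemma dyadicBound_of_isCompact {q : ℝ≥0∞} (hq : 2 ≤ q) {φ : ℝ × ℝ → ℝ} (hφ : Measurable φ)
    {M : ℝ} (hM : 0 ≤ M) {p r : ℝ} {K : Set (ℝ × ℝ)} (hK : IsCompact K)
    (h : ∀ P ∈ K, LocalSublevel φ p r P ∨ LocalSublevel φ r p P) :
    DyadicBound q φ M (sublevelExponent q p r) K := by
  refine hK.induction_on ?_ ?_ ?_ ?_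
  · refine ⟨∅, subset_rfl, MeasurableSet.empty, ⟨0, by simp⟩, 0, le_rfl, fun J σ hm h1 h2 h3 => ?_⟩
    obtain ⟨C, hC, hb⟩ := multiplierBound_of_box hq (A := ∅) MeasurableSet.empty (R := 0) (by simp)
    simpa using hb 0 σ le_rfl hm (fun x => by simp [h3 x]) h3
  · rintro s t hst ⟨A', hA', hrest⟩
    exact ⟨A', hst.trans hA', hrest⟩
  · exact fun s t hs ht => dyadicBound_union hq hs ht
  · intro P hP
    rcases h P hP with hl | hl
    · obtain ⟨U, hU, hb⟩ := dyadicBound_of_localSublevel hq hφ hM hl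
      exact ⟨U, mem_nhdsWithin_of_mem_nhds hU, hb⟩
    · obtain ⟨U, hU, hb⟩ := dyadicBound_of_localSublevel hq hφ hM hl
      rw [sublevelExponent_comm] at hb
      exact ⟨U, mem_nhdsWithin_of_mem_nhds hU, hb⟩

/-- The ratio exceeds `1`, so the sum is comparable to its last power `ρ^J = (2^J)^{1-κ}`, which is
at most `(2t)^{1-κ}`. -/
lemma geom_sum_le_rpow {κ : ℝ} (hκ : κ < 1) : ∃ C : ℝ, 0 ≤ C ∧ ∀ (t : ℝ) (J : ℕ), 0 < t →
    (2 : ℝ) ^ J ≤ 2 * t →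
    1 + ∑ j ∈ Finset.range J, ((2 : ℝ) ^ (1 - κ)) ^ j ≤ C * t ^ (1 - κ) := by
  set ρ : ℝ := (2 : ℝ) ^ (1 - κ) with hρ
  have hρ1 : 1 < ρ := Real.one_lt_rpow (by norm_num) (by linarith)
  refine ⟨(1 + 1 / (ρ - 1)) * ρ, by have := sub_pos.2 hρ1; positivity, fun t J ht hJ => ?_⟩
  have hd := sub_pos.2 hρ1
  have e1 : 1 + ∑ j ∈ Finset.range J, ρ ^ j ≤ (1 + 1 / (ρ - 1)) * ρ ^ J := by
    rw [geom_sum_eq hρ1.ne']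
    have h1 : 1 ≤ ρ ^ J := one_le_pow₀ hρ1.le
    have h2 : (ρ ^ J - 1) / (ρ - 1) ≤ ρ ^ J / (ρ - 1) := by gcongr; linarith
    calc _ ≤ ρ ^ J + ρ ^ J / (ρ - 1) := add_le_add h1 h2
      _ = _ := by ring
  have e2 : ρ ^ J ≤ ρ * t ^ (1 - κ) := by
    calc ρ ^ J = ((2 : ℝ) ^ J) ^ (1 - κ) := by
          rw [hρ, ← Real.rpow_natCast, ← Real.rpow_natCast, ← Real.rpow_mul (by norm_num),
            ← Real.rpow_mul (by norm_num), mul_comm]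
      _ ≤ (2 * t) ^ (1 - κ) := Real.rpow_le_rpow (by positivity) hJ (by linarith)
      _ = _ := Real.mul_rpow (by norm_num) ht.le
  calc _ ≤ _ := e1
    _ ≤ (1 + 1 / (ρ - 1)) * (ρ * t ^ (1 - κ)) := by gcongr
    _ = _ := by ring

/-- In the critical case the ratio is `1` and the sum merely counts the layers, of which there are
`O(1 + log t)`. -/
lemma geom_sum_le_log {t : ℝ} (ht : 1 ≤ t) {J : ℕ} (hJ : (2 : ℝ) ^ J ≤ 2 * t) :
    1 + ∑ j ∈ Finset.range J, ((2 : ℝ) ^ (1 - (1 : ℝ))) ^ j ≤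
      4 * japaneseBracket (Real.log t) := by
  have h0 : 0 ≤ Real.log t := Real.log_nonneg ht
  have h1 : (J : ℝ) * Real.log 2 ≤ Real.log 2 + Real.log t := by
    rw [← Real.log_pow, ← Real.log_mul (by norm_num) (by linarith)]
    exact Real.log_le_log (by positivity) hJ
  have hl : (1 / 2 : ℝ) < Real.log 2 := by linarith [Real.log_two_gt_d9]
  have h2 : (J : ℝ) ≤ 1 + 2 * Real.log t := by
    by_contra hcon
    push Not at hcon
    nlinarith
  have h3 : 1 ≤ japaneseBracket (Real.log t) := Real.one_le_sqrt.2 (by nlinarith)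
  have h4 : Real.log t ≤ japaneseBracket (Real.log t) := Real.le_sqrt_of_sq_le (by linarith)
  have : 1 + ∑ j ∈ Finset.range J, ((2 : ℝ) ^ (1 - (1 : ℝ))) ^ j = 1 + J := by simp
  rw [this]
  linarith

/-! ### Lengths of slices of sublevel sets -/

lemma volume_le_of_pairwise_dist_le {E : Set ℝ} {d : ℝ}
    (h : ∀ x ∈ E, ∀ y ∈ E, x ≤ y → y - x ≤ d) : volume E ≤ ENNReal.ofReal d := by
  refine (Real.volume_le_diam E).trans (Metric.ediam_le fun x hx y hy => ?_)
  rw [edist_dist]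
  refine ENNReal.ofReal_le_ofReal ?_
  rcases le_total x y with hxy | hxy
  · rw [dist_comm, Real.dist_eq, abs_of_nonneg (by linarith)]; exact h x hx y hy hxy
  · rw [Real.dist_eq, abs_of_nonneg (by linarith)]; exact h y hy x hx hxy

lemma mul_sub_le_of_le_deriv {h h' : ℝ → ℝ} {c x y : ℝ} (hxy : x ≤ y)
    (hd : ∀ s, HasDerivAt h (h' s) s) (hc : ∀ s ∈ Icc x y, c ≤ h' s) :
    c * (y - x) ≤ h y - h x := by
  refine (convex_Icc x y).mul_sub_le_image_sub_of_le_deriv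
    (fun s _ => (hd s).continuousAt.continuousWithinAt)
    (fun s _ => (hd s).differentiableAt.differentiableWithinAt)
    (fun s hs => ?_) x (left_mem_Icc.2 hxy) y (right_mem_Icc.2 hxy) hxy
  rw [(hd s).deriv]
  exact hc s (interior_subset hs)

/-- The values of `h` at two points of the set differ by at most `2δ`, while `h` grows at rate at
least `c` between them. -/
lemma volume_sublevel_le_of_le_deriv {h h' : ℝ → ℝ} {I : Set ℝ} (hI : I.OrdConnected) {c δ : ℝ}
    (hc : 0 < c) (hd : ∀ s, HasDerivAt h (h' s) s) (hb : ∀ s ∈ I, c ≤ h' s) :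
    volume {s | s ∈ I ∧ |h s| ≤ δ} ≤ ENNReal.ofReal (2 / c * δ) := by
  refine volume_le_of_pairwise_dist_le fun x hx y hy hxy => ?_
  have h1 := mul_sub_le_of_le_deriv hxy hd (fun s hs => hb s (hI.out hx.1 hy.1 hs))
  have h2 := abs_le.1 hx.2
  have h3 := abs_le.1 hy.2
  rw [div_mul_eq_mul_div, le_div_iff₀ hc]
  linarith

/-- The set is divided according to the sign of `h'`, with no need to locate a critical point.
Between two points of the same half, convexity makes `|h|` vary by at least `(c/2)(y - x)²`, while
the variation is at most `2δ`. The two halves account for the factor `2`. -/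
lemma volume_sublevel_le_of_le_deriv2 {h h' h'' : ℝ → ℝ} {I : Set ℝ} (hI : I.OrdConnected)
    {c δ : ℝ} (hc : 0 < c) (hd : ∀ s, HasDerivAt h (h' s) s) (hd' : ∀ s, HasDerivAt h' (h'' s) s)
    (hb : ∀ s ∈ I, c ≤ h'' s) :
    volume {s | s ∈ I ∧ |h s| ≤ δ} ≤ ENNReal.ofReal (2 * Real.sqrt (4 * δ / c)) := by
  have hsq : ∀ x y : ℝ, |h x| ≤ δ → |h y| ≤ δ → c / 2 * (y - x) ^ 2 ≤ |h y - h x| →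
      y - x ≤ Real.sqrt (4 * δ / c) := by
    intro x y hx hy hxy
    refine Real.le_sqrt_of_sq_le ?_
    rw [le_div_iff₀ hc]
    have := abs_sub (h y) (h x)
    nlinarith
  have h1 : volume {s | (s ∈ I ∧ |h s| ≤ δ) ∧ 0 ≤ h' s} ≤
      ENNReal.ofReal (Real.sqrt (4 * δ / c)) := by
    refine volume_le_of_pairwise_dist_le fun x hx y hy hxy => hsq x y hx.1.2 hy.1.2 ?_
    -- Comparison with the parabola issued from the left endpoint: `h'(x) ≥ 0` and `h'' ≥ c` make
    -- the difference nondecreasing to the right of `x`.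
    have hk : ∀ s, HasDerivAt (fun s => h s - c / 2 * (s - x) ^ 2) (h' s - c * (s - x)) s := by
      intro s
      have := (hd s).sub ((((hasDerivAt_id s).sub_const x).pow 2).const_mul (c / 2))
      refine this.congr_deriv ?_
      simp; ring
    have := mul_sub_le_of_le_deriv (c := 0) hxy hk (fun s hs => by
      have := mul_sub_le_of_le_deriv hs.1 hd' (fun r hr => hb r (hI.out hx.1.1 hy.1.1
        ⟨hr.1, hr.2.trans hs.2⟩))
      have h0 : 0 ≤ h' x := hx.2
      linarith)
    refine le_trans ?_ (le_abs_self _)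
    simp at this
    linarith
  have h2 : volume {s | (s ∈ I ∧ |h s| ≤ δ) ∧ h' s ≤ 0} ≤
      ENNReal.ofReal (Real.sqrt (4 * δ / c)) := by
    refine volume_le_of_pairwise_dist_le fun x hx y hy hxy => hsq x y hx.1.2 hy.1.2 ?_
    -- The mirror image, with the parabola based at the right endpoint, where `h'(y) ≤ 0`.
    have hk : ∀ s, HasDerivAt (fun s => -h s + c / 2 * (y - s) ^ 2) (-h' s - c * (y - s)) s := by
      intro s
      have := (hd s).neg.add ((((hasDerivAt_id s).const_sub y).pow 2).const_mul (c / 2))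
      refine this.congr_deriv ?_
      simp; ring
    have := mul_sub_le_of_le_deriv (c := 0) hxy hk (fun s hs => by
      have := mul_sub_le_of_le_deriv hs.2 hd' (fun r hr => hb r (hI.out hx.1.1 hy.1.1
        ⟨hs.1.trans hr.1, hr.2⟩))
      have h0 : h' y ≤ 0 := hy.2
      linarith)
    refine le_trans ?_ (neg_le_abs _)
    simp at this
    linarith
  have hsub : {s | s ∈ I ∧ |h s| ≤ δ} ⊆
      {s | (s ∈ I ∧ |h s| ≤ δ) ∧ 0 ≤ h' s} ∪ {s | (s ∈ I ∧ |h s| ≤ δ) ∧ h' s ≤ 0} := by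
    intro s hs
    rcases le_total 0 (h' s) with h0 | h0
    · exact Or.inl ⟨hs, h0⟩
    · exact Or.inr ⟨hs, h0⟩
  refine (measure_mono hsub).trans ((measure_union_le _ _).trans ((add_le_add h1 h2).trans_eq ?_))
  rw [← ENNReal.ofReal_add (Real.sqrt_nonneg _) (Real.sqrt_nonneg _)]
  congr 1; ring

/-- Near `P`, the slices of `{|φ| ≤ δ}` in the direction `v` have length `O(δ ^ e)`. -/
def SliceExponent (φ : ℝ × ℝ → ℝ) (P v : ℝ × ℝ) (e : ℝ) : Prop :=
  ∃ ρ : ℝ, 0 < ρ ∧ ∃ C : ℝ, 0 ≤ C ∧ ∀ (x₀ : ℝ × ℝ) (δ : ℝ), 0 < δ → δ ≤ 1 →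
    volume {s : ℝ | x₀ + s • v ∈ Metric.ball P ρ ∧ |φ (x₀ + s • v)| ≤ δ} ≤
      ENNReal.ofReal (C * δ ^ e)

namespace SliceExponent

variable {φ : ℝ × ℝ → ℝ} {P v : ℝ × ℝ} {e : ℝ}

lemma mono {e' : ℝ} (h : SliceExponent φ P v e) (he : e' ≤ e) : SliceExponent φ P v e' := by
  obtain ⟨ρ, hρ, C, hC, H⟩ := h
  refine ⟨ρ, hρ, C, hC, fun x₀ δ h0 h1 => (H x₀ δ h0 h1).trans (ENNReal.ofReal_le_ofReal ?_)⟩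
  exact mul_le_mul_of_nonneg_left (Real.rpow_le_rpow_of_exponent_ge h0 h1 he) hC

lemma of_neg (h : SliceExponent (fun x => -φ x) P v e) : SliceExponent φ P v e := by
  simpa only [SliceExponent, abs_neg] using h

lemma volume_line_ball_le (hv : v ≠ 0) (ρ : ℝ) (x₀ : ℝ × ℝ) :
    volume {s : ℝ | x₀ + s • v ∈ Metric.ball P ρ} ≤ ENNReal.ofReal (2 * ρ / ‖v‖) := by
  refine volume_le_of_pairwise_dist_le fun x hx y hy hxy => ?_
  rw [le_div_iff₀ (norm_pos_iff.2 hv)]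
  have h1 : dist (x₀ + y • v) (x₀ + x • v) = (y - x) * ‖v‖ := by
    rw [dist_eq_norm, add_sub_add_left_eq_sub, ← sub_smul, norm_smul,
      Real.norm_of_nonneg (by linarith)]
  rw [← h1]
  have := dist_triangle_right (x₀ + y • v) (x₀ + x • v) P
  have h2 : dist (x₀ + y • v) P < ρ := hy
  have h3 : dist (x₀ + x • v) P < ρ := hx
  linarith

lemma ordConnected_line_ball (ρ : ℝ) (x₀ : ℝ × ℝ) :
    {s : ℝ | x₀ + s • v ∈ Metric.ball P ρ}.OrdConnected := by
  have h := (convex_ball P ρ).affine_preimage (AffineMap.lineMap x₀ (x₀ + v) : ℝ →ᵃ[ℝ] ℝ × ℝ)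
  have e : {s : ℝ | x₀ + s • v ∈ Metric.ball P ρ} =
      (AffineMap.lineMap x₀ (x₀ + v) : ℝ →ᵃ[ℝ] ℝ × ℝ) ⁻¹' Metric.ball P ρ := by
    ext s
    rw [mem_preimage, AffineMap.lineMap_apply]
    simp [add_comm]
  rw [e]
  exact h.ordConnected

lemma zero (hv : v ≠ 0) : SliceExponent φ P v 0 := by
  refine ⟨1, one_pos, 2 * 1 / ‖v‖, by positivity, fun x₀ δ h0 h1 => ?_⟩
  rw [Real.rpow_zero, mul_one]
  exact (measure_mono fun s hs => hs.1).trans (volume_line_ball_le hv 1 x₀)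

/-- Near `P` the sublevel set is empty for `δ < c`. For `δ ≥ c` the length of the chord suffices,
since `(δ / c)^e ≥ 1`; this explains the factor `c⁻¹ ^ e` in the constant. -/
lemma of_ne_zero (hφ : Continuous φ) (hv : v ≠ 0) (h : φ P ≠ 0) (he : 0 ≤ e) :
    SliceExponent φ P v e := by
  have hc : 0 < |φ P| / 2 := by positivity
  have hn : ∀ᶠ x in 𝓝 P, |φ P| / 2 < |φ x| :=
    (hφ.abs.tendsto P).eventually (lt_mem_nhds (by linarith))
  obtain ⟨ρ, hρ, hb⟩ := Metric.eventually_nhds_iff_ball.1 hn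
  set c := |φ P| / 2 with hcdef
  refine ⟨ρ, hρ, 2 * ρ / ‖v‖ * c⁻¹ ^ e, by positivity, fun x₀ δ h0 h1 => ?_⟩
  rcases lt_or_ge δ c with hlt | hge
  · have : {s : ℝ | x₀ + s • v ∈ Metric.ball P ρ ∧ |φ (x₀ + s • v)| ≤ δ} = ∅ := by
      refine eq_empty_of_forall_notMem fun s hs => ?_
      have := hb _ hs.1
      linarith [hs.2]
    rw [this, measure_empty]; exact zero_le
  · refine (measure_mono fun s hs => hs.1).trans ((volume_line_ball_le hv ρ x₀).trans ?_)
    refine ENNReal.ofReal_le_ofReal ?_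
    rw [mul_assoc, ← Real.mul_rpow (by positivity) h0.le]
    refine le_mul_of_one_le_right (by positivity) (Real.one_le_rpow ?_ he)
    rw [inv_mul_eq_div, one_le_div hc]
    exact hge

lemma hasDerivAt_line (hφ : ContDiff ℝ ∞ φ) (x₀ v : ℝ × ℝ) (s : ℝ) :
    HasDerivAt (fun s : ℝ => φ (x₀ + s • v)) (fderiv ℝ φ (x₀ + s • v) v) s := by
  have h1 : HasDerivAt (fun s : ℝ => x₀ + s • v) v s := by
    simpa using ((hasDerivAt_id s).smul_const v).const_add x₀
  exact ((hφ.differentiable (by simp)) _).hasFDerivAt.comp_hasDerivAt s h1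

lemma hasDerivAt_line2 (hφ : ContDiff ℝ ∞ φ) (x₀ v : ℝ × ℝ) (s : ℝ) :
    HasDerivAt (fun s : ℝ => fderiv ℝ φ (x₀ + s • v) v)
      (fderiv ℝ (fderiv ℝ φ) (x₀ + s • v) v v) s := by
  have h1 : HasDerivAt (fun s : ℝ => x₀ + s • v) v s := by
    simpa using ((hasDerivAt_id s).smul_const v).const_add x₀
  have h2 : ContDiff ℝ ∞ (fderiv ℝ φ) := hφ.fderiv_right (by simp)
  have h3 := ((h2.differentiable (by simp)) (x₀ + s • v)).hasFDerivAt.comp_hasDerivAt s h1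
  exact (ContinuousLinearMap.apply ℝ ℝ v).hasFDerivAt.comp_hasDerivAt s h3

lemma of_fderiv_pos (hφ : ContDiff ℝ ∞ φ) (h : 0 < fderiv ℝ φ P v) : SliceExponent φ P v 1 := by
  have hcont : Continuous fun x => fderiv ℝ φ x v :=
    (hφ.continuous_fderiv (by simp)).clm_apply continuous_const
  have hn : ∀ᶠ x in 𝓝 P, fderiv ℝ φ P v / 2 < fderiv ℝ φ x v :=
    (hcont.tendsto P).eventually (lt_mem_nhds (by linarith))
  obtain ⟨ρ, hρ, hb⟩ := Metric.eventually_nhds_iff_ball.1 hn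
  refine ⟨ρ, hρ, 2 / (fderiv ℝ φ P v / 2), by positivity, fun x₀ δ h0 h1 => ?_⟩
  rw [Real.rpow_one]
  exact volume_sublevel_le_of_le_deriv (ordConnected_line_ball ρ x₀) (by positivity)
    (hasDerivAt_line hφ x₀ v) (fun s hs => (hb _ hs).le)

lemma of_fderiv_ne_zero (hφ : ContDiff ℝ ∞ φ) (h : fderiv ℝ φ P v ≠ 0) :
    SliceExponent φ P v 1 := by
  rcases h.lt_or_gt with h | h
  · refine of_neg (of_fderiv_pos hφ.neg ?_)
    rw [fderiv_fun_neg]; simpa using h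
  · exact of_fderiv_pos hφ h

lemma of_fderiv2_pos (hφ : ContDiff ℝ ∞ φ) (h : 0 < fderiv ℝ (fderiv ℝ φ) P v v) :
    SliceExponent φ P v (1 / 2) := by
  have h2 : ContDiff ℝ ∞ (fderiv ℝ φ) := hφ.fderiv_right (by simp)
  have hcont : Continuous fun x => fderiv ℝ (fderiv ℝ φ) x v v :=
    ((h2.continuous_fderiv (by simp)).clm_apply continuous_const).clm_apply continuous_const
  have hn : ∀ᶠ x in 𝓝 P, fderiv ℝ (fderiv ℝ φ) P v v / 2 < fderiv ℝ (fderiv ℝ φ) x v v :=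
    (hcont.tendsto P).eventually (lt_mem_nhds (by linarith))
  obtain ⟨ρ, hρ, hb⟩ := Metric.eventually_nhds_iff_ball.1 hn
  set c := fderiv ℝ (fderiv ℝ φ) P v v / 2 with hc
  have hc0 : 0 < c := by positivity
  refine ⟨ρ, hρ, 2 * Real.sqrt (4 / c), by positivity, fun x₀ δ h0 h1 => ?_⟩
  refine (volume_sublevel_le_of_le_deriv2 (ordConnected_line_ball ρ x₀) hc0
    (hasDerivAt_line hφ x₀ v) (hasDerivAt_line2 hφ x₀ v) (fun s hs => (hb _ hs).le)).trans_eq ?_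
  rw [← Real.sqrt_eq_rpow, mul_assoc, ← Real.sqrt_mul (by positivity)]
  congr 3; ring

lemma of_fderiv2_ne_zero (hφ : ContDiff ℝ ∞ φ) (h : fderiv ℝ (fderiv ℝ φ) P v v ≠ 0) :
    SliceExponent φ P v (1 / 2) := by
  rcases h.lt_or_gt with h | h
  · refine of_neg (of_fderiv2_pos hφ.neg ?_)
    have : fderiv ℝ (fun x => -φ x) = fun x => -fderiv ℝ φ x := by
      ext1 x; exact fderiv_fun_neg
    rw [this, fderiv_fun_neg]; simpa using h
  · exact of_fderiv2_pos hφ h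

lemma localSublevel (hφ : Continuous φ) {p r : ℝ} (h : SliceExponent φ P (1, 0) p)
    (h' : SliceExponent φ P (0, 1) r) : LocalSublevel φ p r P := by
  obtain ⟨ρ, hρ, C, hC, H⟩ := h
  obtain ⟨ρ', hρ', C', hC', H'⟩ := h'
  refine ⟨Metric.ball P (min ρ ρ'), Metric.isOpen_ball, Metric.mem_ball_self (lt_min hρ hρ'),
    ⟨‖P‖ + ρ, fun x hx => ?_⟩, C + C', add_nonneg hC hC', fun δ h0 h1 => ⟨?_, fun η => ?_, fun ξ => ?_⟩⟩
  · have hx' : ‖x - P‖ < ρ := by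
      rw [← dist_eq_norm]; exact lt_of_lt_of_le hx (min_le_left _ _)
    have h3 : ‖x‖ ≤ ‖P‖ + ρ := by
      have := norm_add_le P (x - P)
      rw [add_sub_cancel] at this
      linarith
    exact ⟨(norm_fst_le x).trans h3, (norm_snd_le x).trans h3⟩
  · exact Metric.isOpen_ball.measurableSet.inter (measurableSet_le hφ.abs.measurable measurable_const)
  · refine le_trans (measure_mono fun s hs => ?_) ((H (0, η) δ h0 h1).trans
      (ENNReal.ofReal_le_ofReal ?_))
    · have e : ((0, η) : ℝ × ℝ) + s • ((1, 0) : ℝ × ℝ) = (s, η) := by simp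
      simp only [mem_ofPred_eq, e] at hs ⊢
      exact ⟨Metric.ball_subset_ball (min_le_left _ _) hs.1, hs.2⟩
    · gcongr; linarith
  · refine le_trans (measure_mono fun s hs => ?_) ((H' (ξ, 0) δ h0 h1).trans
      (ENNReal.ofReal_le_ofReal ?_))
    · have e : ((ξ, 0) : ℝ × ℝ) + s • ((0, 1) : ℝ × ℝ) = (ξ, s) := by simp
      simp only [mem_ofPred_eq, e] at hs ⊢
      exact ⟨Metric.ball_subset_ball (min_le_right _ _) hs.1, hs.2⟩
    · gcongr; linarith

end SliceExponent

/-! ### Slices near the time-resonant set -/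

lemma localSublevel_of_ne_zero {φ : ℝ × ℝ → ℝ} (hφ : Continuous φ) {P : ℝ × ℝ} (h : φ P ≠ 0)
    {p r : ℝ} (hp : 0 ≤ p) (hr : 0 ≤ r) : LocalSublevel φ p r P :=
  SliceExponent.localSublevel hφ (SliceExponent.of_ne_zero hφ (by simp) h hp)
    (SliceExponent.of_ne_zero hφ (by simp) h hr)

/-- Definiteness of the Hessian makes both pure second derivatives along the coordinate axes
nonzero. -/
lemma localSublevel_of_orderTwo {φ : ℝ × ℝ → ℝ} (hφ : ContDiff ℝ ∞ φ) {P : ℝ × ℝ}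
    (h : VanishesAtOrderTwo φ P) : LocalSublevel φ (1 / 2) (1 / 2) P := by
  have hv : ∀ v : ℝ × ℝ, v ≠ 0 → fderiv ℝ (fderiv ℝ φ) P v v ≠ 0 := by
    intro v hv
    rcases h.2.2 with h | h
    · exact (h v hv).ne'
    · exact (h v hv).ne
  exact SliceExponent.localSublevel hφ.continuous
    (SliceExponent.of_fderiv2_ne_zero hφ (hv _ (by simp)))
    (SliceExponent.of_fderiv2_ne_zero hφ (hv _ (by simp)))

lemma apply_eq_coords (L : ℝ × ℝ →L[ℝ] ℝ) (v : ℝ × ℝ) :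
    L v = v.1 * L (1, 0) + v.2 * L (0, 1) := by
  have : v = v.1 • ((1, 0) : ℝ × ℝ) + v.2 • ((0, 1) : ℝ × ℝ) := by ext <;> simp
  calc L v = L (v.1 • ((1, 0) : ℝ × ℝ) + v.2 • ((0, 1) : ℝ × ℝ)) := by rw [← this]
    _ = _ := by rw [map_add, map_smul, map_smul, smul_eq_mul, smul_eq_mul]

lemma fst_ne_zero_or_snd_ne_zero {L : ℝ × ℝ →L[ℝ] ℝ} (hL : L ≠ 0) :
    L (1, 0) ≠ 0 ∨ L (0, 1) ≠ 0 := by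
  by_contra! h
  refine hL (ContinuousLinearMap.ext fun v => ?_)
  rw [apply_eq_coords, h.1, h.2]; simp

/-- At least one partial derivative is nonzero and controls the slices along its axis; along the
other axis the trivial bound is used. -/
lemma localSublevel_of_orderOne {φ : ℝ × ℝ → ℝ} (hφ : ContDiff ℝ ∞ φ) {P : ℝ × ℝ}
    (h : VanishesAtOrderOne φ P) : LocalSublevel φ 1 0 P ∨ LocalSublevel φ 0 1 P := by
  rcases fst_ne_zero_or_snd_ne_zero h.2 with h1 | h1
  · exact Or.inl (SliceExponent.localSublevel hφ.continuous
      (SliceExponent.of_fderiv_ne_zero hφ h1) (SliceExponent.zero (by simp)))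
  · exact Or.inr (SliceExponent.localSublevel hφ.continuous
      (SliceExponent.zero (by simp)) (SliceExponent.of_fderiv_ne_zero hφ h1))

namespace IsLocalParam

variable {φ : ℝ × ℝ → ℝ} {P : ℝ × ℝ} {γ : ℝ → ℝ × ℝ}

lemma hasDerivAt (h : IsLocalParam {x | φ x = 0} P γ) (s : ℝ) : HasDerivAt γ (deriv γ s) s :=
  ((h.smooth.differentiable (by simp)) s).hasDerivAt

/-- The parametrization stays in `Γ` near `0`, so `φ ∘ γ` vanishes identically there and can be
differentiated repeatedly. -/
lemma eventually_fderiv_eq_zero (h : IsLocalParam {x | φ x = 0} P γ) (hφ : ContDiff ℝ ∞ φ) :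
    ∀ᶠ s in 𝓝 (0 : ℝ), fderiv ℝ φ (γ s) (deriv γ s) = 0 := by
  have h1 : ∀ᶠ s in 𝓝 (0 : ℝ), φ (γ s) = 0 := by
    have : ∀ᶠ x in Filter.map γ (𝓝 0), φ x = 0 := by
      rw [h.map_nhds]; exact self_mem_nhdsWithin
    exact this
  filter_upwards [h1.eventually_nhds] with s hs
  have h2 : HasDerivAt (fun s => φ (γ s)) (fderiv ℝ φ (γ s) (deriv γ s)) s :=
    ((hφ.differentiable (by simp)) _).hasFDerivAt.comp_hasDerivAt s (h.hasDerivAt s)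
  have h3 : (fun s => φ (γ s)) =ᶠ[𝓝 s] fun _ => (0 : ℝ) := hs
  rw [← h2.deriv, h3.deriv_eq, deriv_const]

lemma fderiv_tangent (h : IsLocalParam {x | φ x = 0} P γ) (hφ : ContDiff ℝ ∞ φ) :
    fderiv ℝ φ P (deriv γ 0) = 0 := by
  have := (h.eventually_fderiv_eq_zero hφ).self_of_nhds
  rwa [h.base] at this

/-- The second derivative of `φ ∘ γ` at `0`. It relates the Hessian of `φ` along the tangent to the
acceleration of `γ`, hence to the curvature. -/
lemma fderiv2_tangent (h : IsLocalParam {x | φ x = 0} P γ) (hφ : ContDiff ℝ ∞ φ) :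
    fderiv ℝ (fderiv ℝ φ) P (deriv γ 0) (deriv γ 0) + fderiv ℝ φ P (deriv (deriv γ) 0) = 0 := by
  have hφ' : ContDiff ℝ ∞ (fderiv ℝ φ) := hφ.fderiv_right (by simp)
  have hγ' : ContDiff ℝ ∞ (deriv γ) := (contDiff_infty_iff_deriv.1 h.smooth).2
  have h1 : HasDerivAt (fun s => fderiv ℝ φ (γ s)) (fderiv ℝ (fderiv ℝ φ) (γ 0) (deriv γ 0)) 0 :=
    ((hφ'.differentiable (by simp)) _).hasFDerivAt.comp_hasDerivAt 0 (h.hasDerivAt 0)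
  have h2 := h1.clm_apply ((hγ'.differentiable (by simp)) 0).hasDerivAt
  have h3 : (fun s => fderiv ℝ φ (γ s) (deriv γ s)) =ᶠ[𝓝 0] fun _ => (0 : ℝ) :=
    h.eventually_fderiv_eq_zero hφ
  have h4 := h2.deriv
  rw [h3.deriv_eq, deriv_const, h.base] at h4
  exact h4.symm

end IsLocalParam

/-- The gradient annihilates the tangent. If one partial derivative vanished, the tangent would be
parallel to the corresponding axis. -/
lemma localSublevel_of_nonCharacteristic {φ : ℝ × ℝ → ℝ} (hφ : ContDiff ℝ ∞ φ) {P : ℝ × ℝ}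
    (h : VanishesAtOrderOne φ P) {γ : ℝ → ℝ × ℝ} (hγ : IsLocalParam {x | φ x = 0} P γ)
    (hc : ¬ IsCharacteristic (deriv γ 0)) : LocalSublevel φ 1 1 P := by
  have ht := hγ.fderiv_tangent hφ
  rw [apply_eq_coords] at ht
  simp only [IsCharacteristic, not_or] at hc
  have h12 : fderiv ℝ φ P (1, 0) ≠ 0 ∧ fderiv ℝ φ P (0, 1) ≠ 0 := by
    rcases fst_ne_zero_or_snd_ne_zero h.2 with h1 | h1
    · refine ⟨h1, fun h2 => ?_⟩
      rw [h2, mul_zero, add_zero] at ht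
      exact mul_ne_zero hc.1 h1 ht
    · refine ⟨fun h2 => ?_, h1⟩
      rw [h2, mul_zero, zero_add] at ht
      exact mul_ne_zero hc.2.1 h1 ht
  exact SliceExponent.localSublevel hφ.continuous (SliceExponent.of_fderiv_ne_zero hφ h12.1)
    (SliceExponent.of_fderiv_ne_zero hφ h12.2)

/-- If both partial derivatives are nonzero, both slices have exponent `1`, more than needed. If one
vanishes, the tangent lies along that axis, and nonzero curvature gives the acceleration a component
transverse to it. The identity for the second derivative of `φ ∘ γ` then makes the pure second
derivative along that axis nonzero, which gives exponent `1/2` there. -/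
lemma localSublevel_of_curved {φ : ℝ × ℝ → ℝ} (hφ : ContDiff ℝ ∞ φ) {P : ℝ × ℝ}
    (h : VanishesAtOrderOne φ P) {γ : ℝ → ℝ × ℝ} (hγ : IsLocalParam {x | φ x = 0} P γ)
    (hc : signedCurvature γ 0 ≠ 0) :
    LocalSublevel φ 1 (1 / 2) P ∨ LocalSublevel φ (1 / 2) 1 P := by
  have ht := hγ.fderiv_tangent hφ
  have ht2 := hγ.fderiv2_tangent hφ
  have hnum : (deriv γ 0).1 * (deriv (deriv γ) 0).2 - (deriv γ 0).2 * (deriv (deriv γ) 0).1 ≠ 0 := by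
    intro h0
    exact hc (by rw [signedCurvature, h0, zero_div])
  rw [apply_eq_coords] at ht
  rw [apply_eq_coords (fderiv ℝ φ P)] at ht2
  by_cases h1 : fderiv ℝ φ P (1, 0) = 0
  · have h2 : fderiv ℝ φ P (0, 1) ≠ 0 := (fst_ne_zero_or_snd_ne_zero h.2).resolve_left (by simp [h1])
    rw [h1, mul_zero, zero_add] at ht ht2
    have hτ : (deriv γ 0).2 = 0 := (mul_eq_zero.1 ht).resolve_right h2
    rw [hτ, zero_mul, sub_zero] at hnum
    have hne : fderiv ℝ (fderiv ℝ φ) P (1, 0) (1, 0) ≠ 0 := by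
      intro h0
      have e : deriv γ 0 = (deriv γ 0).1 • ((1, 0) : ℝ × ℝ) := by ext <;> simp [hτ]
      rw [e, map_smul, map_smul, _root_.smul_apply, h0, smul_zero, smul_zero,
        zero_add] at ht2
      exact hnum (by rw [(mul_eq_zero.1 ht2).resolve_right h2, mul_zero])
    exact Or.inr (SliceExponent.localSublevel hφ.continuous
      (SliceExponent.of_fderiv2_ne_zero hφ hne) (SliceExponent.of_fderiv_ne_zero hφ h2))
  by_cases h2 : fderiv ℝ φ P (0, 1) = 0
  · rw [h2, mul_zero, add_zero] at ht ht2
    have hτ : (deriv γ 0).1 = 0 := (mul_eq_zero.1 ht).resolve_right h1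
    rw [hτ, zero_mul, zero_sub] at hnum
    have hne : fderiv ℝ (fderiv ℝ φ) P (0, 1) (0, 1) ≠ 0 := by
      intro h0
      have e : deriv γ 0 = (deriv γ 0).2 • ((0, 1) : ℝ × ℝ) := by ext <;> simp [hτ]
      rw [e, map_smul, map_smul, _root_.smul_apply, h0, smul_zero, smul_zero,
        zero_add] at ht2
      exact hnum (by rw [(mul_eq_zero.1 ht2).resolve_right h1, mul_zero, neg_zero])
    exact Or.inl (SliceExponent.localSublevel hφ.continuous
      (SliceExponent.of_fderiv_ne_zero hφ h1) (SliceExponent.of_fderiv2_ne_zero hφ hne))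
  · exact Or.inl (SliceExponent.localSublevel hφ.continuous
      (SliceExponent.of_fderiv_ne_zero hφ h1)
      ((SliceExponent.of_fderiv_ne_zero hφ h2).mono (by norm_num)))

/-! ### Weak solutions: uniqueness -/

lemma memLp_two_of_smooth {χ : ℝ → ℂ} (hχ : ContDiff ℝ ∞ χ) (hs : HasCompactSupport χ) :
    MemLp χ 2 volume := hχ.continuous.memLp_of_hasCompactSupport hs

lemma integral_hatL2_mul_conj_eq_inner (u : L2) {k : ℝ → ℂ} (hk : MemLp k 2 volume) :
    ∫ ξ, hatL2 u ξ * conj (k ξ) = inner ℂ (hk.toLp : L2) (hatIsometry u) := by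
  rw [inner_L2_eq_integral]
  refine integral_congr_ae ?_
  filter_upwards [hk.coeFn_toLp, coeFn_hatIsometry u] with ξ h1 h2
  rw [h1, h2]

lemma integrable_hatL2_mul_conj (u : L2) {k : ℝ → ℂ} (hk : MemLp k 2 volume) :
    Integrable fun ξ => hatL2 u ξ * conj (k ξ) :=
  (memLp_hatL2 u).integrable_mul hk.star

lemma integral_hatL2_sub_mul (u v : L2) {k : ℝ → ℂ} (hk : MemLp k 2 volume) :
    ∫ ξ, hatL2 (u - v) ξ * conj (k ξ) =
      (∫ ξ, hatL2 u ξ * conj (k ξ)) - ∫ ξ, hatL2 v ξ * conj (k ξ) := by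
  rw [integral_hatL2_mul_conj_eq_inner _ hk, integral_hatL2_mul_conj_eq_inner _ hk,
    integral_hatL2_mul_conj_eq_inner _ hk, map_sub, inner_sub_right]

lemma norm_integral_hatL2_mul_conj_le (u : L2) {k l : ℝ → ℂ} (hk : MemLp k 2 volume)
    (hl : MemLp l 2 volume) {r : ℝ} (h : ∀ ξ, ‖k ξ‖ ≤ r * ‖l ξ‖) :
    ‖∫ ξ, hatL2 u ξ * conj (k ξ)‖ ≤ r * ‖(hl.toLp : L2)‖ * ‖u‖ := by
  rw [integral_hatL2_mul_conj_eq_inner u hk]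
  refine (norm_inner_le_norm _ _).trans ?_
  rw [LinearIsometry.norm_map]
  gcongr
  refine Lp.norm_le_mul_norm_of_ae_le_mul ?_
  filter_upwards [hk.coeFn_toLp, hl.coeFn_toLp] with ξ h1 h2
  rw [h1, h2]; exact h ξ

lemma norm_exp_I_mul_real (r : ℝ) : ‖Complex.exp (Complex.I * (r : ℂ))‖ = 1 :=
  Complex.norm_exp_I_mul_ofReal r

lemma hasDerivAt_exp_I_mul (b t : ℝ) :
    HasDerivAt (fun s : ℝ => Complex.exp (Complex.I * ((s * b : ℝ) : ℂ)))
      (Complex.I * b * Complex.exp (Complex.I * ((t * b : ℝ) : ℂ))) t := by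
  have h1 : HasDerivAt (fun s : ℝ => Complex.I * ((s * b : ℝ) : ℂ)) (Complex.I * b) t := by
    have := (((hasDerivAt_id t).mul_const b).ofReal_comp).const_mul Complex.I
    simpa using this
  simpa [mul_comm] using h1.cexp

lemma hasDerivAt_integral_exp {b : ℝ → ℝ} (hb : Measurable b) {w : ℝ → ℂ} (hw : Integrable w)
    (hbw : Integrable fun ξ => (b ξ : ℂ) * w ξ) (t : ℝ) :
    HasDerivAt (fun s : ℝ => ∫ ξ, Complex.exp (Complex.I * ((s * b ξ : ℝ) : ℂ)) * w ξ)
      (∫ ξ, Complex.I * b ξ * Complex.exp (Complex.I * ((t * b ξ : ℝ) : ℂ)) * w ξ) t := by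
  have hm : ∀ s : ℝ, AEStronglyMeasurable
      (fun ξ => Complex.exp (Complex.I * ((s * b ξ : ℝ) : ℂ)) * w ξ) volume := fun s =>
    (by fun_prop : Measurable fun ξ =>
      Complex.exp (Complex.I * ((s * b ξ : ℝ) : ℂ))).aestronglyMeasurable.mul hw.1
  refine (hasDerivAt_integral_of_dominated_loc_of_deriv_le
    (bound := fun ξ => ‖(b ξ : ℂ) * w ξ‖)
    (F := fun (s : ℝ) ξ => Complex.exp (Complex.I * ((s * b ξ : ℝ) : ℂ)) * w ξ)
    (F' := fun (s : ℝ) ξ => Complex.I * b ξ * Complex.exp (Complex.I * ((s * b ξ : ℝ) : ℂ)) * w ξ)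
    (s := univ) univ_mem (Eventually.of_forall hm) ?_ ?_ ?_ hbw.norm ?_).2
  · refine hw.norm.mono' (hm t) (Eventually.of_forall fun ξ => ?_)
    rw [norm_mul, norm_exp_I_mul_real, one_mul]
  · exact (by fun_prop : Measurable fun ξ => Complex.I * (b ξ : ℂ) *
      Complex.exp (Complex.I * ((t * b ξ : ℝ) : ℂ))).aestronglyMeasurable.mul hw.1
  · refine Eventually.of_forall fun ξ s _ => ?_
    rw [norm_mul, norm_mul, norm_mul, norm_exp_I_mul_real, norm_mul, Complex.norm_I]; simp
  · exact Eventually.of_forall fun ξ s _ => (hasDerivAt_exp_I_mul (b ξ) s).mul_const (w ξ)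

/-- The multiplication of a test function by `e^{ita}`. -/
def modulate (a : ℝ → ℝ) (t : ℝ) (χ : ℝ → ℂ) (ξ : ℝ) : ℂ :=
  Complex.exp (Complex.I * ((t * a ξ : ℝ) : ℂ)) * χ ξ

section TestFunctions

variable {a : ℝ → ℝ} {χ : ℝ → ℂ}

lemma contDiff_ofReal_mul (ha : ContDiff ℝ ∞ a) (hχ : ContDiff ℝ ∞ χ) :
    ContDiff ℝ ∞ fun ξ => (a ξ : ℂ) * χ ξ :=
  (Complex.ofRealCLM.contDiff.comp ha).mul hχ

lemma contDiff_modulate (ha : ContDiff ℝ ∞ a) (hχ : ContDiff ℝ ∞ χ) (t : ℝ) :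
    ContDiff ℝ ∞ (modulate a t χ) := by
  have h : ContDiff ℝ ∞ fun ξ => Complex.I * ((t * a ξ : ℝ) : ℂ) :=
    contDiff_const.mul (Complex.ofRealCLM.contDiff.comp (contDiff_const.mul ha))
  exact h.cexp.mul hχ

lemma hasCompactSupport_modulate (hs : HasCompactSupport χ) (t : ℝ) :
    HasCompactSupport (modulate a t χ) := hs.mul_left

lemma norm_modulate (t ξ : ℝ) : ‖modulate a t χ ξ‖ = ‖χ ξ‖ := by
  rw [modulate, norm_mul, norm_exp_I_mul_real, one_mul]

lemma norm_modulate_sub_le (s t ξ : ℝ) :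
    ‖modulate a s χ ξ - modulate a t χ ξ‖ ≤ |s - t| * ‖(a ξ : ℂ) * χ ξ‖ := by
  have e : modulate a s χ ξ - modulate a t χ ξ = Complex.exp (Complex.I * ((t * a ξ : ℝ) : ℂ)) *
      (Complex.exp (Complex.I * (((s - t) * a ξ : ℝ) : ℂ)) - 1) * χ ξ := by
    have : Complex.exp (Complex.I * ((s * a ξ : ℝ) : ℂ)) =
        Complex.exp (Complex.I * ((t * a ξ : ℝ) : ℂ)) *
          Complex.exp (Complex.I * (((s - t) * a ξ : ℝ) : ℂ)) := by
      rw [← Complex.exp_add]; congr 1; push_cast; ring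
    rw [modulate, modulate, this]; ring
  rw [e, norm_mul, norm_mul, norm_exp_I_mul_real, one_mul, norm_mul, ← mul_assoc]
  gcongr
  refine Real.norm_exp_I_mul_ofReal_sub_one_le.trans_eq ?_
  rw [norm_mul, Complex.norm_real, Real.norm_eq_abs]

end TestFunctions

/-- Disposes of the cross term in a product rule where one factor is Lipschitz and the other only
continuous. -/
lemma hasDerivAt_zero_of_norm_le {k : ℝ → ℂ} {ε : ℝ → ℝ} {t : ℝ} (hε : Tendsto ε (𝓝 t) (𝓝 0))
    (hk : ∀ s, ‖k s‖ ≤ |s - t| * ε s) : HasDerivAt k 0 t := by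
  have h0 : k t = 0 := by simpa using hk t
  rw [hasDerivAt_iff_isLittleO, Asymptotics.isLittleO_iff]
  intro c hc
  filter_upwards [hε.eventually (gt_mem_nhds hc)] with s hs
  rw [h0, sub_zero, smul_zero, sub_zero, Real.norm_eq_abs, mul_comm]
  exact (hk s).trans (by gcongr)

lemma eq_zero_of_integral_hatL2 {u : L2}
    (h : ∀ χ : ℝ → ℂ, ContDiff ℝ ∞ χ → HasCompactSupport χ →
      ∫ ξ, hatL2 u ξ * conj (χ ξ) = 0) : u = 0 := by
  have h1 : ∀ᵐ ξ, hatL2 u ξ = 0 := by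
    refine ae_eq_zero_of_integral_contDiff_smul_eq_zero
      ((memLp_hatL2 u).locallyIntegrable (by norm_num)) fun g hg hgs => ?_
    rw [← h (fun x => (g x : ℂ)) (Complex.ofRealCLM.contDiff.comp hg)
      (hgs.comp_left (g := fun r : ℝ => (r : ℂ)) rfl)]
    refine integral_congr_ae (Eventually.of_forall fun x => ?_)
    simp [mul_comm]
  have h2 : hatIsometry u = 0 := by
    rw [hatIsometry_eq_iff]
    filter_upwards [h1, Lp.coeFn_zero ℂ 2 (volume : Measure ℝ)] with ξ h1 h2
    rw [h1, h2]; rfl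
  exact (map_eq_zero_iff hatIsometry hatIsometry.injective).1 h2

lemma SolvesDispersive.hasDerivAt_hat {a : ℝ → ℝ} (ha : ContDiff ℝ ∞ a) {N : ℝ → ℝ → ℂ} {u₀ : L2}
    {u : ℝ → L2} (h : SolvesDispersive a N u₀ u) {χ : ℝ → ℂ} (hχ : ContDiff ℝ ∞ χ)
    (hs : HasCompactSupport χ) (t : ℝ) :
    HasDerivAt (fun s : ℝ => ∫ ξ, hatL2 (u s) ξ * conj (χ ξ))
      (Complex.I * ((∫ ξ, hatL2 (u t) ξ * conj ((a ξ : ℂ) * χ ξ))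
        - ∫ x : ℝ, N t x * conj (invHat χ x))) t := by
  have := h.equation χ hχ hs t
  simp_rw [integral_mul_conj_invHat hχ hs] at this
  rwa [integral_mul_conj_invHat (contDiff_ofReal_mul ha hχ) hs.mul_left] at this

/-- Weak solutions are determined by their data. -/
lemma SolvesDispersive.unique {a : ℝ → ℝ} (ha : ContDiff ℝ ∞ a) {N : ℝ → ℝ → ℂ} {u₀ : L2}
    {u v : ℝ → L2} (hu : SolvesDispersive a N u₀ u) (hv : SolvesDispersive a N u₀ v) : u = v := by
  set D : ℝ → L2 := fun t => u t - v t with hD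
  have hDc : Continuous D := hu.continuous.sub hv.continuous
  have hD0 : D 0 = 0 := by rw [hD]; simp [hu.initial, hv.initial]
  have hweak : ∀ χ : ℝ → ℂ, ContDiff ℝ ∞ χ → HasCompactSupport χ → ∀ t,
      HasDerivAt (fun s => ∫ ξ, hatL2 (D s) ξ * conj (χ ξ))
        (Complex.I * ∫ ξ, hatL2 (D t) ξ * conj ((a ξ : ℂ) * χ ξ)) t := by
    intro χ hχ hs t
    have h := (hu.hasDerivAt_hat ha hχ hs t).sub (hv.hasDerivAt_hat ha hχ hs t)
    have e : (fun s => ∫ ξ, hatL2 (D s) ξ * conj (χ ξ)) = fun s =>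
        (∫ ξ, hatL2 (u s) ξ * conj (χ ξ)) - ∫ ξ, hatL2 (v s) ξ * conj (χ ξ) := by
      ext s
      exact integral_hatL2_sub_mul _ _ (memLp_two_of_smooth hχ hs)
    rw [e]
    refine h.congr_deriv ?_
    rw [integral_hatL2_sub_mul _ _
      (memLp_two_of_smooth (contDiff_ofReal_mul ha hχ) hs.mul_left)]
    ring
  -- The pairing with the test function transported by `e^{ita}` is conserved: the equation for `D`
  -- and the derivative of the modulation cancel. It vanishes at time `0`.
  have hconst : ∀ χ : ℝ → ℂ, ContDiff ℝ ∞ χ → HasCompactSupport χ → ∀ t,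
      ∫ ξ, hatL2 (D t) ξ * conj (modulate a t χ ξ) = 0 := by
    intro χ hχ hs
    have hmem : ∀ t, MemLp (modulate a t χ) 2 volume := fun t =>
      memLp_two_of_smooth (contDiff_modulate ha hχ t) (hasCompactSupport_modulate hs t)
    have haχ := memLp_two_of_smooth (contDiff_ofReal_mul ha hχ) hs.mul_left
    have hder : ∀ t, HasDerivAt (fun s => ∫ ξ, hatL2 (D s) ξ * conj (modulate a s χ ξ)) 0 t := by
      intro t
      have d1 := hweak _ (contDiff_modulate ha hχ t) (hasCompactSupport_modulate hs t) t
      have d2 : HasDerivAt (fun s => ∫ ξ, hatL2 (D t) ξ * conj (modulate a s χ ξ))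
          (-(Complex.I * ∫ ξ, hatL2 (D t) ξ * conj ((a ξ : ℂ) * modulate a t χ ξ))) t := by
        have h := hasDerivAt_integral_exp (b := fun ξ => -a ξ) ha.continuous.neg.measurable
          (integrable_hatL2_mul_conj (D t) (memLp_two_of_smooth hχ hs)) (by
            refine (integrable_hatL2_mul_conj (D t) haχ).neg.congr
              (Eventually.of_forall fun ξ => ?_)
            simp; ring) t
        have e1 : ∀ s ξ, hatL2 (D t) ξ * conj (modulate a s χ ξ) =
            Complex.exp (Complex.I * ((s * -a ξ : ℝ) : ℂ)) * (hatL2 (D t) ξ * conj (χ ξ)) := by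
          intro s ξ
          rw [modulate, map_mul, ← Complex.exp_conj, map_mul, Complex.conj_I, Complex.conj_ofReal]
          have : -Complex.I * ((s * a ξ : ℝ) : ℂ) = Complex.I * ((s * -a ξ : ℝ) : ℂ) := by
            push_cast; ring
          rw [this]; ring
        simp_rw [e1]
        refine h.congr_deriv ?_
        rw [← integral_const_mul, ← integral_neg]
        refine integral_congr_ae (Eventually.of_forall fun ξ => ?_)
        have := e1 t ξ
        simp only [map_mul, Complex.conj_ofReal] at this ⊢
        calc _ = -(Complex.I * (a ξ * (Complex.exp (Complex.I * ((t * -a ξ : ℝ) : ℂ)) *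
              (hatL2 (D t) ξ * conj (χ ξ))))) := by push_cast; ring
          _ = _ := by rw [← this]; ring
      -- The product of the two increments. `D` is only continuous in norm, but the modulation is
      -- Lipschitz in time, so this term is `o(|s - t|)`.
      have d3 : HasDerivAt (fun s => ∫ ξ, hatL2 (D s - D t) ξ *
          conj (modulate a s χ ξ - modulate a t χ ξ)) 0 t := by
        refine hasDerivAt_zero_of_norm_le (ε := fun s => ‖(haχ.toLp : L2)‖ * ‖D s - D t‖) ?_
          fun s => ?_
        · have : Tendsto (fun s => ‖(haχ.toLp : L2)‖ * ‖D s - D t‖) (𝓝 t)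
              (𝓝 (‖(haχ.toLp : L2)‖ * ‖D t - D t‖)) :=
            (continuous_const.mul (hDc.sub continuous_const).norm).tendsto t
          simpa using this
        · rw [← mul_assoc]
          exact norm_integral_hatL2_mul_conj_le _ ((hmem s).sub (hmem t)) haχ
            (fun ξ => norm_modulate_sub_le s t ξ)
      have d := (d1.add d2).add d3
      have e : (fun s => ∫ ξ, hatL2 (D s) ξ * conj (modulate a s χ ξ)) = fun s =>
          ((∫ ξ, hatL2 (D s) ξ * conj (modulate a t χ ξ)) +
          ∫ ξ, hatL2 (D t) ξ * conj (modulate a s χ ξ)) +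
          (∫ ξ, hatL2 (D s - D t) ξ * conj (modulate a s χ ξ - modulate a t χ ξ)) -
          ∫ ξ, hatL2 (D t) ξ * conj (modulate a t χ ξ) := by
        ext s
        have hsub : ∀ w : L2, ∫ ξ, hatL2 w ξ * conj (modulate a s χ ξ - modulate a t χ ξ) =
            (∫ ξ, hatL2 w ξ * conj (modulate a s χ ξ)) -
              ∫ ξ, hatL2 w ξ * conj (modulate a t χ ξ) := by
          intro w
          rw [← integral_sub (integrable_hatL2_mul_conj w (hmem s))
            (integrable_hatL2_mul_conj w (hmem t))]
          refine integral_congr_ae (Eventually.of_forall fun ξ => ?_)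
          simp only [map_sub]; ring
        rw [hsub, integral_hatL2_sub_mul (D s) (D t) (hmem s),
          integral_hatL2_sub_mul (D s) (D t) (hmem t)]
        ring
      rw [e]
      refine (d.sub_const _).congr_deriv ?_
      ring
    intro t
    have hc := is_const_of_deriv_eq_zero (fun s => (hder s).differentiableAt)
      (fun s => (hder s).deriv) t 0
    rw [hc, integral_hatL2_mul_conj_eq_inner _ (hmem 0), hD0, map_zero, inner_zero_right]
  ext1 t
  refine sub_eq_zero.1 (eq_zero_of_integral_hatL2 (u := D t) fun χ hχ hs => ?_)
  -- Modulating by `-t` beforehand cancels the modulation at time `t`, leaving an arbitrary test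
  -- function.
  have h := hconst (modulate a (-t) χ) (contDiff_modulate ha hχ _)
    (hasCompactSupport_modulate hs _) t
  have e : ∀ ξ, modulate a t (modulate a (-t) χ) ξ = χ ξ := by
    intro ξ
    rw [modulate, modulate, ← mul_assoc, ← Complex.exp_add, ← mul_add, ← Complex.ofReal_add]
    simp
  simpa only [e] using h

/-! ### Existence of weak solutions -/

lemma tendsto_zero_of_sq {α : Type*} {l : Filter α} {x : α → ℝ≥0∞}
    (h : Tendsto (fun s => x s ^ 2) l (𝓝 0)) : Tendsto x l (𝓝 0) := by
  have h1 := (ENNReal.continuous_rpow_const (y := 1 / 2)).tendsto 0 |>.comp h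
  have h2 : (0 : ℝ≥0∞) ^ (1 / 2 : ℝ) = 0 := ENNReal.zero_rpow_of_pos (by norm_num)
  rw [h2] at h1
  refine h1.congr fun s => ?_
  rw [Function.comp_apply, ← ENNReal.rpow_natCast, ← ENNReal.rpow_mul]
  norm_num

lemma memLp_modulate {a : ℝ → ℝ} (ha : Measurable a) (f : L2) (t : ℝ) :
    MemLp (modulate a t (hatL2 f)) 2 volume := by
  refine (memLp_hatL2 f).mono ?_ (Eventually.of_forall fun ξ => (norm_modulate t ξ).le)
  have := measurable_hatL2 f
  have : Measurable (modulate a t (hatL2 f)) := by unfold modulate; fun_prop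
  exact this.aestronglyMeasurable

/-- The transform is multiplied by `e^{itb}`. As `b` may be unbounded, continuity in `L²` comes from
dominated convergence rather than a Lipschitz bound. Differentiation is needed only against `χ`, on
whose support `b` is bounded. -/
lemma exists_freeEvolution {b : ℝ → ℝ} (hb : ContDiff ℝ ∞ b) (f : L2) :
    ∃ v : ℝ → L2, SolvesDispersive b (fun _ _ => 0) f v ∧
      ∀ t, hatL2 (v t) =ᵐ[volume] modulate b t (hatL2 f) := by
  have hbm := hb.continuous.measurable
  choose v hv using fun t => exists_hatL2_eq (memLp_modulate hbm f t)
  refine ⟨v, ⟨?_, ?_, ?_⟩, hv⟩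
  · rw [continuous_iff_continuousAt]
    intro t
    rw [ContinuousAt, tendsto_iff_edist_tendsto_0]
    refine tendsto_zero_of_sq ?_
    have e : ∀ s, edist (v s) (v t) ^ 2 =
        ∫⁻ ξ, ‖modulate b s (hatL2 f) ξ - modulate b t (hatL2 f) ξ‖ₑ ^ 2 := by
      intro s
      rw [edist_eq_enorm_sub, ← lintegral_hatL2_sq]
      refine lintegral_congr_ae ?_
      filter_upwards [hatL2_sub (v s) (v t), hv s, hv t] with ξ h1 h2 h3
      rw [h1, h2, h3]
    simp_rw [e]
    have hlim := tendsto_lintegral_filter_of_dominated_convergence (μ := (volume : Measure ℝ))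
      (l := 𝓝 t) (F := fun s ξ => ‖modulate b s (hatL2 f) ξ - modulate b t (hatL2 f) ξ‖ₑ ^ 2)
      (f := fun _ => 0) (fun ξ => (2 * ‖hatL2 f ξ‖ₑ) ^ 2) ?_ ?_ ?_ ?_
    · simpa using hlim
    · refine Eventually.of_forall fun s => ?_
      have := measurable_hatL2 f
      unfold modulate
      fun_prop
    · refine Eventually.of_forall fun s => Eventually.of_forall fun ξ => ?_
      have hn : ∀ r, ‖modulate b r (hatL2 f) ξ‖ₑ = ‖hatL2 f ξ‖ₑ := fun r => by
        rw [← ofReal_norm, norm_modulate, ofReal_norm]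
      have := enorm_sub_le (a := modulate b s (hatL2 f) ξ) (b := modulate b t (hatL2 f) ξ)
      rw [hn, hn, ← two_mul] at this
      exact pow_le_pow_left₀ zero_le this 2
    · simp_rw [mul_pow]
      rw [lintegral_const_mul _ ((measurable_hatL2 f).enorm.pow_const 2), lintegral_hatL2_sq]
      have : ‖f‖ₑ < ⊤ := enorm_lt_top
      finiteness
    · refine Eventually.of_forall fun ξ => ?_
      have hc : Continuous fun s : ℝ =>
          ‖modulate b s (hatL2 f) ξ - modulate b t (hatL2 f) ξ‖ₑ ^ 2 := by
        unfold modulate; fun_prop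
      simpa using hc.tendsto t
  · refine hatL2_injective ?_
    filter_upwards [hv 0] with ξ hξ
    rw [hξ]; simp [modulate]
  · intro χ hχ hs t
    have hχ2 := memLp_two_of_smooth hχ hs
    have hbχ2 := memLp_two_of_smooth (contDiff_ofReal_mul hb hχ) hs.mul_left
    have h := hasDerivAt_integral_exp hbm (integrable_hatL2_mul_conj f hχ2) (by
      refine (integrable_hatL2_mul_conj f hbχ2).congr (Eventually.of_forall fun ξ => ?_)
      simp; ring) t
    have e : ∀ s, ∫ x, v s x * conj (invHat χ x) =
        ∫ ξ, Complex.exp (Complex.I * ((s * b ξ : ℝ) : ℂ)) * (hatL2 f ξ * conj (χ ξ)) := by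
      intro s
      rw [integral_mul_conj_invHat hχ hs]
      refine integral_congr_ae ?_
      filter_upwards [hv s] with ξ hξ
      rw [hξ, modulate]; ring
    simp_rw [e]
    refine h.congr_deriv ?_
    rw [integral_mul_conj_invHat (contDiff_ofReal_mul hb hχ) hs.mul_left]
    simp only [zero_mul, integral_zero, sub_zero]
    rw [← integral_const_mul]
    refine integral_congr_ae ?_
    filter_upwards [hv t] with ξ hξ
    rw [hξ, modulate, map_mul, Complex.conj_ofReal]; ring

/-! ### Duhamel's formula on the Fourier side -/

lemma bilin_congr {σ : ℝ × ℝ → ℂ} {F F' G G' : ℝ → ℂ} (hF : F =ᵐ[volume] F')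
    (hG : G =ᵐ[volume] G') : bilin σ F G = bilin σ F' G' := by
  ext ζ
  refine integral_congr_ae ?_
  have h := (quasiMeasurePreserving_sub_left (volume : Measure ℝ) ζ).ae_eq_comp hG
  filter_upwards [hF, h] with ξ h1 h2
  simp only [Function.comp_apply] at h2
  rw [h1, h2]

/-- The pairing of `T_m(f, g)` with a test function. -/
lemma integral_bilinearMultiplier_mul {m : ℝ × ℝ → ℂ} (hm : AdmissibleSymbol m) (f g : L2)
    {χ : ℝ → ℂ} (hχ : ContDiff ℝ ∞ χ) (hs : HasCompactSupport χ) :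
    ∫ x, bilinearMultiplier m f g x * conj (invHat χ x) =
      ((Real.sqrt (2 * Real.pi) : ℝ) : ℂ) *
        ∫ ζ, bilin m (hatL2 f) (hatL2 g) ζ * conj (χ ζ) := by
  obtain ⟨n, hn⟩ := exists_hatL2_eq (hm.memLp_bilin f g)
  have hn' := ae_eq_invHat_of_hatL2_eq hn (hm.integrable_bilin f g)
  -- Fubini in the total frequency `ζ = ξ + η` shows that `T_m(f, g)` is an inverse transform; the
  -- factor `√(2π)` compensates the normalisation of `invHat`.
  have e1 : ∀ x, bilinearMultiplier m f g x = ((Real.sqrt (2 * Real.pi) : ℝ) : ℂ) *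
      invHat (bilin m (hatL2 f) (hatL2 g)) x := by
    intro x
    rw [invHat, ← mul_assoc, Complex.ofReal_inv, mul_inv_cancel₀ sqrt_two_pi_ne_zero, one_mul]
    have h := hm.integral_bilin_mul f g
      (k := fun ζ => Complex.exp (Complex.I * ((x * ζ : ℝ) : ℂ))) (by fun_prop) (K := 1)
      (fun ζ => (norm_exp_I_mul_real _).le)
    simp_rw [mul_comm (Complex.exp _) (bilin _ _ _ _)]
    rw [h, bilinearMultiplier]
    refine integral_congr_ae (Eventually.of_forall fun p => ?_)
    simp only; ring
  have e2 : ∫ ζ, bilin m (hatL2 f) (hatL2 g) ζ * conj (χ ζ) = ∫ x, n x * conj (invHat χ x) := by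
    rw [integral_mul_conj_invHat hχ hs]
    refine integral_congr_ae ?_
    filter_upwards [hn] with ξ hξ
    rw [hξ]
  rw [e2, ← integral_const_mul]
  refine integral_congr_ae ?_
  filter_upwards [hn'] with x hx
  rw [e1, hx]; ring

/-- `∫₀ᵗ e^{isy} ds`. -/
def duhamelFactor (t y : ℝ) : ℂ :=
  if y = 0 then (t : ℂ) else (Complex.exp (Complex.I * ((t * y : ℝ) : ℂ)) - 1) / (Complex.I * y)

lemma duhamelFactor_zero (y : ℝ) : duhamelFactor 0 y = 0 := by
  by_cases hy : y = 0 <;> simp [duhamelFactor, hy]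

lemma measurable_duhamelFactor (t : ℝ) : Measurable (duhamelFactor t) := by
  unfold duhamelFactor
  exact Measurable.ite (measurableSet_singleton 0) measurable_const (by fun_prop)

lemma hasDerivAt_duhamelFactor (t y : ℝ) :
    HasDerivAt (fun s => duhamelFactor s y) (Complex.exp (Complex.I * ((t * y : ℝ) : ℂ))) t := by
  by_cases hy : y = 0
  · simp only [duhamelFactor, hy, if_true]
    simpa using (hasDerivAt_id t).ofReal_comp
  · simp only [duhamelFactor, hy, if_false]
    have hy' : Complex.I * (y : ℂ) ≠ 0 := mul_ne_zero Complex.I_ne_zero (by exact_mod_cast hy)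
    refine (((hasDerivAt_exp_I_mul y t).sub_const 1).div_const _).congr_deriv ?_
    rw [mul_div_cancel_left₀ _ hy']

lemma norm_duhamelFactor_le (t y : ℝ) : ‖duhamelFactor t y‖ ≤ |t| := by
  by_cases hy : y = 0
  · simp [duhamelFactor, hy]
  · simp only [duhamelFactor, hy, if_false]
    rw [norm_div, norm_mul, Complex.norm_I, one_mul, Complex.norm_real, Real.norm_eq_abs,
      div_le_iff₀ (abs_pos.2 hy), ← abs_mul]
    exact Real.norm_exp_I_mul_ofReal_sub_one_le

lemma norm_duhamelFactor_mul_le (t y : ℝ) : ‖duhamelFactor t y‖ * |y| ≤ 2 := by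
  by_cases hy : y = 0
  · simp [hy]
  · simp only [duhamelFactor, hy, if_false]
    rw [norm_div, norm_mul, Complex.norm_I, one_mul, Complex.norm_real, Real.norm_eq_abs,
      div_mul_cancel₀ _ (abs_pos.2 hy).ne']
    refine (norm_sub_le _ _).trans ?_
    rw [norm_exp_I_mul_real, norm_one]; norm_num

/-- The symbol of the bilinear map `(f, g) ↦ u(t)`. -/
def duhamelSymbol (a b c : ℝ → ℝ) (m : ℝ × ℝ → ℂ) (t : ℝ) (p : ℝ × ℝ) : ℂ :=
  -(Complex.I * ((Real.sqrt (2 * Real.pi) : ℝ) : ℂ)) * m p *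
    (Complex.exp (Complex.I * ((t * a (p.1 + p.2) : ℝ) : ℂ)) * duhamelFactor t (phase a b c p))

/-- The time derivative of `duhamelSymbol`. -/
def duhamelSymbolDeriv (a b c : ℝ → ℝ) (m : ℝ × ℝ → ℂ) (t : ℝ) (p : ℝ × ℝ) : ℂ :=
  Complex.I * a (p.1 + p.2) * duhamelSymbol a b c m t p -
    Complex.I * ((Real.sqrt (2 * Real.pi) : ℝ) : ℂ) * (m p *
      (Complex.exp (Complex.I * ((t * b p.1 : ℝ) : ℂ)) *
        Complex.exp (Complex.I * ((t * c p.2 : ℝ) : ℂ))))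

section DuhamelSymbol

variable {a b c : ℝ → ℝ} {m : ℝ × ℝ → ℂ}

/-- Since `a(ξ+η) + φ(ξ,η) = b(ξ) + c(η)`, the derivative of the Duhamel factor, once multiplied by
`e^{ita}`, becomes the product of the two free evolutions. -/
lemma hasDerivAt_duhamelSymbol (t : ℝ) (p : ℝ × ℝ) :
    HasDerivAt (fun s => duhamelSymbol a b c m s p) (duhamelSymbolDeriv a b c m t p) t := by
  have h := ((hasDerivAt_exp_I_mul (a (p.1 + p.2)) t).mul
    (hasDerivAt_duhamelFactor t (phase a b c p))).const_mul
    (-(Complex.I * ((Real.sqrt (2 * Real.pi) : ℝ) : ℂ)) * m p)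
  refine h.congr_deriv ?_
  have e : Complex.exp (Complex.I * ((t * b p.1 : ℝ) : ℂ)) *
      Complex.exp (Complex.I * ((t * c p.2 : ℝ) : ℂ)) =
      Complex.exp (Complex.I * ((t * a (p.1 + p.2) : ℝ) : ℂ)) *
        Complex.exp (Complex.I * ((t * phase a b c p : ℝ) : ℂ)) := by
    rw [← Complex.exp_add, ← Complex.exp_add, phase]
    congr 1; push_cast; ring
  rw [duhamelSymbolDeriv, e, duhamelSymbol]
  ring

lemma duhamelSymbol_zero (p : ℝ × ℝ) : duhamelSymbol a b c m 0 p = 0 := by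
  rw [duhamelSymbol, duhamelFactor_zero, mul_zero, mul_zero]

lemma duhamelSymbol_eq_zero {p : ℝ × ℝ} (hp : m p = 0) (t : ℝ) :
    duhamelSymbol a b c m t p = 0 := by
  rw [duhamelSymbol, hp]; ring

lemma norm_duhamelSymbol (t : ℝ) (p : ℝ × ℝ) : ‖duhamelSymbol a b c m t p‖ =
    Real.sqrt (2 * Real.pi) * ‖m p‖ * ‖duhamelFactor t (phase a b c p)‖ := by
  rw [duhamelSymbol, norm_mul, norm_mul, norm_mul, norm_neg, norm_mul, norm_exp_I_mul_real,
    Complex.norm_I, Complex.norm_real, Real.norm_of_nonneg (Real.sqrt_nonneg _)]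
  ring

lemma measurable_duhamelSymbol (ha : Continuous a) (hb : Continuous b) (hc : Continuous c)
    (hm : Continuous m) (t : ℝ) : Measurable (duhamelSymbol a b c m t) := by
  have h1 : Measurable fun p : ℝ × ℝ => duhamelFactor t (phase a b c p) := by
    refine (measurable_duhamelFactor t).comp ?_
    unfold phase
    exact Continuous.measurable (by fun_prop)
  have h2 : Measurable fun p : ℝ × ℝ => Complex.exp (Complex.I * ((t * a (p.1 + p.2) : ℝ) : ℂ)) :=
    Continuous.measurable (by fun_prop)
  exact (measurable_const.mul hm.measurable).mul (h2.mul h1)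

lemma norm_duhamelSymbol_le (t : ℝ) (p : ℝ × ℝ) :
    ‖duhamelSymbol a b c m t p‖ ≤ Real.sqrt (2 * Real.pi) * ‖m p‖ * |t| := by
  rw [norm_duhamelSymbol]
  gcongr
  exact norm_duhamelFactor_le _ _

lemma norm_duhamelSymbol_mul_le (t : ℝ) (p : ℝ × ℝ) :
    ‖duhamelSymbol a b c m t p‖ * |phase a b c p| ≤ 2 * Real.sqrt (2 * Real.pi) * ‖m p‖ := by
  rw [norm_duhamelSymbol, mul_assoc]
  calc _ ≤ Real.sqrt (2 * Real.pi) * ‖m p‖ * 2 := by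
        gcongr; exact norm_duhamelFactor_mul_le _ _
    _ = _ := by ring

/-- Bounds for the symbol and the total frequency on its support. -/
lemma exists_symbol_bounds (ha : Continuous a) (hm : Continuous m) (hms : HasCompactSupport m) :
    ∃ M R A : ℝ, 0 ≤ M ∧ 0 ≤ A ∧ (∀ p, ‖m p‖ ≤ M) ∧
      (∀ p ∈ tsupport m, |p.1| ≤ R ∧ |p.2| ≤ R) ∧ ∀ p, m p ≠ 0 → |a (p.1 + p.2)| ≤ A := by
  obtain ⟨M, hM⟩ := hm.bounded_above_of_compact_support hms
  obtain ⟨R, hR⟩ := hms.isCompact.isBounded.exists_norm_le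
  obtain ⟨A, hA⟩ := hms.isCompact.exists_bound_of_continuousOn (f := fun p : ℝ × ℝ => a (p.1 + p.2))
    (by fun_prop)
  refine ⟨M, R, max A 0, (norm_nonneg _).trans (hM 0), le_max_right _ _, hM, fun p hp => ?_,
    fun p hp => ?_⟩
  · exact ⟨(norm_fst_le p).trans (hR p hp), (norm_snd_le p).trans (hR p hp)⟩
  · exact (hA p (subset_tsupport m hp)).trans (le_max_left _ _)

lemma admissibleSymbol_of_smooth (hm : Continuous m) (hms : HasCompactSupport m) :
    AdmissibleSymbol m := by
  obtain ⟨M, R, A, hM, hA, hmM, hR, -⟩ := exists_symbol_bounds (a := fun _ => 0) (by fun_prop) hm hms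
  exact admissibleSymbol_of_bound hm.measurable hmM fun p hp => hR p (subset_tsupport m hp)

lemma admissibleSymbol_duhamelSymbol (ha : Continuous a) (hb : Continuous b) (hc : Continuous c)
    (hm : Continuous m) (hms : HasCompactSupport m) (t : ℝ) :
    AdmissibleSymbol (duhamelSymbol a b c m t) := by
  obtain ⟨M, R, A, hM, hA, hmM, hR, -⟩ := exists_symbol_bounds ha hm hms
  refine admissibleSymbol_of_bound (measurable_duhamelSymbol ha hb hc hm t)
    (M := Real.sqrt (2 * Real.pi) * M * |t|) (R := R)
    (fun p => (norm_duhamelSymbol_le t p).trans (by gcongr; exact hmM p)) fun p hp => ?_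
  exact hR p (subset_tsupport m fun h0 => hp (duhamelSymbol_eq_zero h0 t))

lemma norm_duhamelSymbolDeriv_le {A : ℝ} (hA : 0 ≤ A) (hmA : ∀ p, m p ≠ 0 → |a (p.1 + p.2)| ≤ A)
    {T t : ℝ} (ht : |t| ≤ T) (p : ℝ × ℝ) : ‖duhamelSymbolDeriv a b c m t p‖ ≤
      Real.sqrt (2 * Real.pi) * (A * T + 1) * ‖m p‖ := by
  by_cases hp : m p = 0
  · rw [duhamelSymbolDeriv, duhamelSymbol_eq_zero hp, hp]; simp
  have hT : 0 ≤ T := (abs_nonneg t).trans ht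
  rw [duhamelSymbolDeriv]
  refine (norm_sub_le _ _).trans ?_
  rw [norm_mul, norm_mul, norm_mul, norm_mul, norm_mul, norm_mul, norm_exp_I_mul_real,
    norm_exp_I_mul_real, Complex.norm_I, Complex.norm_real, Complex.norm_real, Real.norm_eq_abs,
    Real.norm_of_nonneg (Real.sqrt_nonneg _)]
  calc _ ≤ 1 * A * (Real.sqrt (2 * Real.pi) * ‖m p‖ * T) +
        1 * Real.sqrt (2 * Real.pi) * (‖m p‖ * (1 * 1)) := by
        gcongr
        · exact hmA p hp
        · exact (norm_duhamelSymbol_le t p).trans (by gcongr)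
    _ = _ := by ring

end DuhamelSymbol

lemma bilin_sub_ae {σ σ' : ℝ × ℝ → ℂ} (hσ : AdmissibleSymbol σ) (hσ' : AdmissibleSymbol σ')
    (f g : L2) : bilin (fun p => σ p - σ' p) (hatL2 f) (hatL2 g) =ᵐ[volume]
      fun ζ => bilin σ (hatL2 f) (hatL2 g) ζ - bilin σ' (hatL2 f) (hatL2 g) ζ := by
  filter_upwards [hσ.ae_integrable f g, hσ'.ae_integrable f g] with ζ h h'
  rw [bilin, bilin, bilin, ← integral_sub h h']
  refine integral_congr_ae (Eventually.of_forall fun ξ => ?_)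
  simp only; ring

lemma continuous_of_dist_le_mul {u : ℝ → L2}
    (h : ∀ T : ℝ, 0 ≤ T → ∃ K : ℝ, ∀ s t : ℝ, |s| ≤ T → |t| ≤ T → ‖u s - u t‖ ≤ K * |s - t|) :
    Continuous u := by
  rw [continuous_iff_continuousAt]
  intro t
  obtain ⟨K, hK⟩ := h (|t| + 1) (by positivity)
  rw [ContinuousAt, tendsto_iff_norm_sub_tendsto_zero]
  have hlim : Tendsto (fun s : ℝ => K * |s - t|) (𝓝 t) (𝓝 0) := by
    have hc : Continuous fun s : ℝ => K * |s - t| := by fun_prop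
    simpa using hc.tendsto t
  refine squeeze_zero' (Eventually.of_forall fun s => norm_nonneg _) ?_ hlim
  filter_upwards [Metric.ball_mem_nhds t one_pos] with s hs
  refine hK s t ?_ (by linarith)
  rw [Metric.mem_ball, Real.dist_eq] at hs
  have := abs_sub_abs_le_abs_sub s t
  linarith

/-- Duhamel's formula. -/
lemma exists_duhamel {a b c : ℝ → ℝ} (ha : ContDiff ℝ ∞ a) (hb : ContDiff ℝ ∞ b)
    (hc : ContDiff ℝ ∞ c) {m : ℝ × ℝ → ℂ} (hm : ContDiff ℝ ∞ m) (hms : HasCompactSupport m)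
    (f g : L2) {v w : ℝ → L2} (hv : ∀ t, hatL2 (v t) =ᵐ[volume] modulate b t (hatL2 f))
    (hw : ∀ t, hatL2 (w t) =ᵐ[volume] modulate c t (hatL2 g)) :
    ∃ u : ℝ → L2, SolvesDispersive a (fun t => bilinearMultiplier m (v t) (w t)) 0 u ∧
      ∀ t, hatL2 (u t) =ᵐ[volume] bilin (duhamelSymbol a b c m t) (hatL2 f) (hatL2 g) := by
  have hac := ha.continuous
  have hbc := hb.continuous
  have hcc := hc.continuous
  have hmc := hm.continuous
  have hadm := admissibleSymbol_duhamelSymbol hac hbc hcc hmc hms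
  have hmadm := admissibleSymbol_of_smooth hmc hms
  obtain ⟨M, R, A, hM, hA, hmM, hR, hmA⟩ := exists_symbol_bounds hac hmc hms
  choose u hu using fun t => exists_hatL2_eq ((hadm t).memLp_bilin f g)
  refine ⟨u, ⟨?_, ?_, ?_⟩, hu⟩
  · refine continuous_of_dist_le_mul fun T hT => ?_
    -- Continuity of `u`: the symbol is Lipschitz in time on bounded intervals, uniformly in the
    -- frequencies, and the crude `L²` bound is applied to the difference of symbols.
    obtain ⟨C, hC, hbox⟩ := multiplierBound_of_box (q := 2) le_rfl
      (isClosed_tsupport m).measurableSet hR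
    set K := Real.sqrt (2 * Real.pi) * (A * T + 1) * M with hK
    have hK0 : 0 ≤ K := by positivity
    refine ⟨C * K * ‖f‖ * ‖g‖, fun s t hs ht => ?_⟩
    have hd : hatL2 (u s - u t) =ᵐ[volume] bilin
        (fun p => duhamelSymbol a b c m s p - duhamelSymbol a b c m t p) (hatL2 f) (hatL2 g) := by
      filter_upwards [hatL2_sub (u s) (u t), hu s, hu t, bilin_sub_ae (hadm s) (hadm t) f g]
        with ζ h1 h2 h3 h4
      rw [h1, h2, h3, h4]
    have hb := hbox (K * |s - t|) _ (by positivity) ((hadm s).measurable.sub (hadm t).measurable)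
      (fun p => ?_) (fun p hp => ?_) f g _ hd
    · rw [← Lp.enorm_def, ← ofReal_norm, ← ofReal_norm, ← ofReal_norm,
        ← ENNReal.ofReal_mul (by positivity), ← ENNReal.ofReal_mul (by positivity),
        ENNReal.ofReal_le_ofReal_iff (by positivity)] at hb
      refine hb.trans_eq (by ring)
    · have hconv := (convex_Icc (-T) T).norm_image_sub_le_of_norm_hasDerivWithin_le (C := K)
        (f := fun s => duhamelSymbol a b c m s p) (f' := fun s => duhamelSymbolDeriv a b c m s p)
        (fun r _ => (hasDerivAt_duhamelSymbol r p).hasDerivWithinAt)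
        (fun r hr => (norm_duhamelSymbolDeriv_le hA hmA (abs_le.2 hr) p).trans (by
          rw [hK]; gcongr; exact hmM p)) (abs_le.1 ht) (abs_le.1 hs)
      simpa using hconv
    · have h0 : m p = 0 := image_eq_zero_of_notMem_tsupport hp
      simp [duhamelSymbol_eq_zero h0]
  · refine hatL2_injective ?_
    have h0 : hatL2 (0 : L2) =ᵐ[volume] fun _ => 0 := by
      filter_upwards [hatL2_sub (0 : L2) 0] with ξ hξ
      rw [sub_zero] at hξ
      rw [hξ, sub_self]
    filter_upwards [hu 0, h0] with ζ h1 h2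
    rw [h1, h2, bilin]
    simp [duhamelSymbol_zero]
  · intro χ hχ hs t
    obtain ⟨B, hB⟩ := hχ.continuous.bounded_above_of_compact_support hs
    have hkm : Measurable fun ζ => conj (χ ζ) :=
      (Complex.continuous_conj.comp hχ.continuous).measurable
    have hkB : ∀ ζ, ‖conj (χ ζ)‖ ≤ B := fun ζ => by rw [RCLike.norm_conj]; exact hB ζ
    have e : ∀ s, ∫ x, u s x * conj (invHat χ x) = ∫ p : ℝ × ℝ,
        hatL2 f p.1 * hatL2 g p.2 * duhamelSymbol a b c m s p * conj (χ (p.1 + p.2)) := by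
      intro s
      rw [integral_mul_conj_invHat hχ hs, ← (hadm s).integral_bilin_mul f g hkm hkB]
      refine integral_congr_ae ?_
      filter_upwards [hu s] with ζ hζ
      rw [hζ]
    have hFG : Measurable fun p : ℝ × ℝ => hatL2 f p.1 * hatL2 g p.2 := by
      have h1 := measurable_hatL2 f
      have h2 := measurable_hatL2 g
      fun_prop
    have hk2 : Measurable fun p : ℝ × ℝ => conj (χ (p.1 + p.2)) :=
      hkm.comp (by fun_prop : Measurable fun p : ℝ × ℝ => p.1 + p.2)
    have hint : ∀ {σ : ℝ × ℝ → ℂ}, AdmissibleSymbol σ → ∀ {k : ℝ → ℂ}, Continuous k →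
        HasCompactSupport k → Integrable fun p : ℝ × ℝ =>
          hatL2 f p.1 * hatL2 g p.2 * σ p * conj (k (p.1 + p.2)) := by
      intro σ hσ k hk hks
      obtain ⟨B, hB⟩ := hk.bounded_above_of_compact_support hks
      refine (hσ.integrable_prod f g).mul_bdd (c := B) ?_ (Eventually.of_forall fun p => ?_)
      · exact Continuous.aestronglyMeasurable (by fun_prop)
      · rw [RCLike.norm_conj]; exact hB _
    set K := Real.sqrt (2 * Real.pi) * (A * (|t| + 1) + 1) with hK
    have hK0 : 0 ≤ K := by positivity
    have hB0 : 0 ≤ B := (norm_nonneg _).trans (hB 0)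
    have hDm : Measurable (duhamelSymbolDeriv a b c m t) := by
      have h1 := measurable_duhamelSymbol hac hbc hcc hmc t
      have h2 : Measurable fun p : ℝ × ℝ => Complex.I * (a (p.1 + p.2) : ℂ) :=
        Continuous.measurable (by fun_prop)
      have h3 : Measurable fun p : ℝ × ℝ => Complex.I * ((Real.sqrt (2 * Real.pi) : ℝ) : ℂ) * (m p *
          (Complex.exp (Complex.I * ((t * b p.1 : ℝ) : ℂ)) *
            Complex.exp (Complex.I * ((t * c p.2 : ℝ) : ℂ)))) :=
        Continuous.measurable (by fun_prop)
      exact (h2.mul h1).sub h3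
    -- Differentiation under the integral over the plane, dominated near `t` by a multiple of `|f̂ ĝ
    -- m|`.
    have hder := (hasDerivAt_integral_of_dominated_loc_of_deriv_le (x₀ := t)
      (s := Metric.ball t 1) (Metric.ball_mem_nhds t one_pos)
      (F := fun s (p : ℝ × ℝ) =>
        hatL2 f p.1 * hatL2 g p.2 * duhamelSymbol a b c m s p * conj (χ (p.1 + p.2)))
      (F' := fun s (p : ℝ × ℝ) =>
        hatL2 f p.1 * hatL2 g p.2 * duhamelSymbolDeriv a b c m s p * conj (χ (p.1 + p.2)))
      (bound := fun p => K * B * ‖hatL2 f p.1 * hatL2 g p.2 * m p‖)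
      (μ := (volume : Measure (ℝ × ℝ)))
      (Eventually.of_forall fun s =>
        ((hFG.mul (hadm s).measurable).mul hk2).aestronglyMeasurable)
      (hint (hadm t) hχ.continuous hs)
      ((hFG.mul hDm).mul hk2).aestronglyMeasurable
      (Eventually.of_forall fun p s hs' => ?_)
      ((hmadm.integrable_prod f g).norm.const_mul _)
      (Eventually.of_forall fun p s _ =>
        ((hasDerivAt_duhamelSymbol s p).const_mul _).mul_const _)).2
    · simp_rw [e]
      refine hder.congr_deriv ?_
      have hχc := contDiff_ofReal_mul ha hχ
      obtain ⟨B', hB'⟩ := hχc.continuous.bounded_above_of_compact_support hs.mul_left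
      have e3 : ∫ x, u t x * conj (invHat (fun ξ => (a ξ : ℂ) * χ ξ) x) = ∫ p : ℝ × ℝ,
          hatL2 f p.1 * hatL2 g p.2 * duhamelSymbol a b c m t p *
            conj ((a (p.1 + p.2) : ℂ) * χ (p.1 + p.2)) := by
        rw [integral_mul_conj_invHat hχc hs.mul_left]
        rw [← (hadm t).integral_bilin_mul f g (k := fun ζ => conj ((a ζ : ℂ) * χ ζ))
          (Complex.continuous_conj.comp hχc.continuous).measurable
          (fun ζ => by rw [RCLike.norm_conj]; exact hB' ζ)]
        refine integral_congr_ae ?_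
        filter_upwards [hu t] with ζ hζ
        rw [hζ]
      -- The modulations of `v(t)` and `w(t)` are absorbed into the symbol, so that the forcing term
      -- is expressed through the initial data `f`, `g`.
      set m' : ℝ × ℝ → ℂ := fun p => m p * (Complex.exp (Complex.I * ((t * b p.1 : ℝ) : ℂ)) *
        Complex.exp (Complex.I * ((t * c p.2 : ℝ) : ℂ))) with hm'
      have hm'adm : AdmissibleSymbol m' :=
        admissibleSymbol_of_smooth (by rw [hm']; fun_prop) hms.mul_right
      have e4 : ∫ x, bilinearMultiplier m (v t) (w t) x * conj (invHat χ x) =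
          ((Real.sqrt (2 * Real.pi) : ℝ) : ℂ) * ∫ p : ℝ × ℝ,
            hatL2 f p.1 * hatL2 g p.2 * m' p * conj (χ (p.1 + p.2)) := by
        rw [integral_bilinearMultiplier_mul hmadm _ _ hχ hs, bilin_congr (hv t) (hw t),
          ← hm'adm.integral_bilin_mul f g hkm hkB]
        congr 1
        refine integral_congr_ae (Eventually.of_forall fun ζ => ?_)
        simp only
        congr 1
        refine integral_congr_ae (Eventually.of_forall fun ξ => ?_)
        simp only [modulate, hm']; ring
      rw [e3, e4, ← integral_const_mul, ← integral_sub, ← integral_const_mul]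
      · refine integral_congr_ae (Eventually.of_forall fun p => ?_)
        simp only [duhamelSymbolDeriv, hm', map_mul, Complex.conj_ofReal]
        ring
      · exact hint (hadm t) hχc.continuous hs.mul_left
      · exact (hint hm'adm hχ.continuous hs).const_mul _
    · have hs'' : |s| ≤ |t| + 1 := by
        rw [Metric.mem_ball, Real.dist_eq] at hs'
        have := abs_sub_abs_le_abs_sub s t
        linarith
      rw [norm_mul, norm_mul _ (duhamelSymbolDeriv a b c m s p), norm_mul _ (m p)]
      calc _ ≤ ‖hatL2 f p.1 * hatL2 g p.2‖ * (K * ‖m p‖) * B := by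
            gcongr
            · exact norm_duhamelSymbolDeriv_le hA hmA hs'' p
            · exact hkB _
        _ = _ := by ring

lemma exists_solution {a b c : ℝ → ℝ} (ha : ContDiff ℝ ∞ a) (hb : ContDiff ℝ ∞ b)
    (hc : ContDiff ℝ ∞ c) {m : ℝ × ℝ → ℂ} (hm : ContDiff ℝ ∞ m) (hms : HasCompactSupport m)
    (f g : L2) : ∃ U : (ℝ → L2) × (ℝ → L2) × (ℝ → L2), IsSolution a b c m f g U ∧
      ∀ t, hatL2 (U.1 t) =ᵐ[volume] bilin (duhamelSymbol a b c m t) (hatL2 f) (hatL2 g) := by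
  obtain ⟨v, hv, hv'⟩ := exists_freeEvolution hb f
  obtain ⟨w, hw, hw'⟩ := exists_freeEvolution hc g
  obtain ⟨u, hu, hu'⟩ := exists_duhamel ha hb hc hm hms f g hv' hw'
  exact ⟨(u, v, w), ⟨hu, hv, hw⟩, hu'⟩

/-- The free components are determined first, so the two equations for `u` have the same right-hand
side. -/
lemma IsSolution.unique {a b c : ℝ → ℝ} (ha : ContDiff ℝ ∞ a) (hb : ContDiff ℝ ∞ b)
    (hc : ContDiff ℝ ∞ c) {m : ℝ × ℝ → ℂ} {f g : L2} {U V : (ℝ → L2) × (ℝ → L2) × (ℝ → L2)}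
    (hU : IsSolution a b c m f g U) (hV : IsSolution a b c m f g V) : U = V := by
  have hv : U.2.1 = V.2.1 := hU.eq_v.unique hb hV.eq_v
  have hw : U.2.2 = V.2.2 := hU.eq_w.unique hc hV.eq_w
  have hu := hU.eq_u
  rw [hv, hw] at hu
  exact Prod.ext (hu.unique ha hV.eq_u) (Prod.ext hv hw)

/-! ### Bounds for the solutions -/

lemma contDiff_phase {a b c : ℝ → ℝ} (ha : ContDiff ℝ ∞ a) (hb : ContDiff ℝ ∞ b)
    (hc : ContDiff ℝ ∞ c) : ContDiff ℝ ∞ (phase a b c) := by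
  unfold phase
  exact (((ha.comp (contDiff_fst.add contDiff_snd)).neg.add (hb.comp contDiff_fst)).add
    (hc.comp contDiff_snd))

section Bounds

variable {a b c : ℝ → ℝ} {m : ℝ × ℝ → ℂ} {q : ℝ≥0∞}

/-- By uniqueness, an arbitrary solution is the one given by Duhamel's formula, to which the
multiplier bound applies. -/
lemma solutionBound_of_multiplierBound (ha : ContDiff ℝ ∞ a) (hb : ContDiff ℝ ∞ b)
    (hc : ContDiff ℝ ∞ c) (hm : ContDiff ℝ ∞ m) (hms : HasCompactSupport m) {α : ℝ → ℝ}
    (h : ∃ C : ℝ, ∀ t, 0 ≤ t → MultiplierBound q (duhamelSymbol a b c m t) (C * α t)) :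
    SolutionBound a b c m q α := by
  obtain ⟨C, hC⟩ := h
  refine ⟨C, fun f g U hU t ht => ?_⟩
  obtain ⟨V, hV, hVt⟩ := exists_solution ha hb hc hm hms f g
  rw [hU.unique ha hb hc hV]
  refine (hC t ht f g _ (hVt t)).trans_eq ?_
  rw [← ofReal_norm, ← ofReal_norm, ← ENNReal.ofReal_mul' (norm_nonneg _),
    ← ENNReal.ofReal_mul' (norm_nonneg _)]

lemma exists_multiplierBound_mul_time (ha : Continuous a) (hb : Continuous b) (hc : Continuous c)
    (hm : Continuous m) (hms : HasCompactSupport m) (hq : 2 ≤ q) :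
    ∃ C : ℝ, 0 ≤ C ∧ ∀ t, 0 ≤ t → MultiplierBound q (duhamelSymbol a b c m t) (C * t) := by
  obtain ⟨M, R, A, hM, hA, hmM, hR, hmA⟩ := exists_symbol_bounds ha hm hms
  obtain ⟨C, hC, hbox⟩ := multiplierBound_of_box hq (isClosed_tsupport m).measurableSet hR
  refine ⟨C * (Real.sqrt (2 * Real.pi) * M), by positivity, fun t ht => ?_⟩
  rw [mul_assoc]
  refine hbox _ _ (by positivity) (measurable_duhamelSymbol ha hb hc hm t) (fun p => ?_)
    (fun p hp => duhamelSymbol_eq_zero (image_eq_zero_of_notMem_tsupport hp) t)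
  refine (norm_duhamelSymbol_le t p).trans ?_
  rw [abs_of_nonneg ht]
  gcongr
  exact hmM p

/-- By compactness `|φ|` is bounded below on the support of `m`, so the symbol is bounded uniformly
in time. -/
lemma exists_multiplierBound_of_nonresonant (ha : Continuous a) (hb : Continuous b)
    (hc : Continuous c) (hm : Continuous m) (hms : HasCompactSupport m) (hq : 2 ≤ q)
    (hΓ : timeResonantSet a b c = ∅) :
    ∃ C : ℝ, ∀ t, 0 ≤ t → MultiplierBound q (duhamelSymbol a b c m t) (C * 1) := by
  obtain ⟨M, R, A, hM, hA, hmM, hR, hmA⟩ := exists_symbol_bounds ha hm hms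
  obtain ⟨C, hC, hbox⟩ := multiplierBound_of_box hq (isClosed_tsupport m).measurableSet hR
  have hφ0 : ∀ p, phase a b c p ≠ 0 := fun p hp => by
    have : p ∈ timeResonantSet a b c := hp
    rw [hΓ] at this
    exact this
  have hφc : Continuous (phase a b c) := by unfold phase; fun_prop
  obtain ⟨B, hB⟩ := hms.isCompact.exists_bound_of_continuousOn
    (f := fun p => (phase a b c p)⁻¹) (hφc.inv₀ hφ0).continuousOn
  have hB' : ∀ p ∈ tsupport m, 1 ≤ |B| * |phase a b c p| := by
    intro p hp
    have h1 := (hB p hp).trans (le_abs_self B)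
    rw [norm_inv, Real.norm_eq_abs, inv_le_iff_one_le_mul₀ (abs_pos.2 (hφ0 p))] at h1
    exact h1
  refine ⟨C * (|B| * (2 * Real.sqrt (2 * Real.pi) * M)), fun t ht => ?_⟩
  rw [mul_one]
  refine hbox _ _ (by positivity) (measurable_duhamelSymbol ha hb hc hm t) (fun p => ?_)
    (fun p hp => duhamelSymbol_eq_zero (image_eq_zero_of_notMem_tsupport hp) t)
  by_cases hp : p ∈ tsupport m
  · calc ‖duhamelSymbol a b c m t p‖
        ≤ ‖duhamelSymbol a b c m t p‖ * (|B| * |phase a b c p|) :=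
          le_mul_of_one_le_right (norm_nonneg _) (hB' p hp)
      _ = |B| * (‖duhamelSymbol a b c m t p‖ * |phase a b c p|) := by ring
      _ ≤ |B| * (2 * Real.sqrt (2 * Real.pi) * ‖m p‖) := by
          exact mul_le_mul_of_nonneg_left (norm_duhamelSymbol_mul_le t p) (abs_nonneg _)
      _ ≤ _ := by gcongr; exact hmM p
  · rw [duhamelSymbol_eq_zero (image_eq_zero_of_notMem_tsupport hp), norm_zero]
    positivity

/-- The bound for large times in terms of the lengths of the slices of `{|φ| ≤ δ}`. -/
lemma exists_multiplierBound_of_localSublevel (ha : ContDiff ℝ ∞ a) (hb : ContDiff ℝ ∞ b)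
    (hc : ContDiff ℝ ∞ c) (hm : ContDiff ℝ ∞ m) (hms : HasCompactSupport m) (hq : 2 ≤ q) {p r : ℝ}
    (hp : 0 ≤ p) (hr : 0 ≤ r)
    (h : ∀ P ∈ timeResonantSet a b c,
      LocalSublevel (phase a b c) p r P ∨ LocalSublevel (phase a b c) r p P) :
    ∃ C : ℝ, 0 ≤ C ∧ ∀ t, 1 ≤ t → ∃ J : ℕ, (2 : ℝ) ^ J ≤ 2 * t ∧
      MultiplierBound q (duhamelSymbol a b c m t)
        (C * (1 + ∑ j ∈ Finset.range J, ((2 : ℝ) ^ (1 - sublevelExponent q p r)) ^ j)) := by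
  obtain ⟨M, R, A, hM, hA, hmM, hR, hmA⟩ := exists_symbol_bounds ha.continuous hm.continuous hms
  have hφ := (contDiff_phase ha hb hc).continuous
  -- The factor `2` comes from `|e^{ity} - 1| ≤ 2`; this one constant serves both bounds on the
  -- symbol.
  set M' := 2 * Real.sqrt (2 * Real.pi) * M with hM'
  obtain ⟨K, hK, -, -, C, hC, H⟩ := dyadicBound_of_isCompact hq hφ.measurable (M := M')
    (by positivity) hms.isCompact (p := p) (r := r) fun P _ => by
      by_cases hP : P ∈ timeResonantSet a b c
      · exact h P hP
      · exact Or.inl (localSublevel_of_ne_zero hφ hP hp hr)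
  refine ⟨C, hC, fun t ht => ?_⟩
  -- Here `2^n ≤ t < 2^{n+1}`. Taking `J = n + 1` gives both `t ≤ 2^J`, needed for the size of the
  -- symbol, and `2^J ≤ 2t`, needed to sum the series.
  obtain ⟨n, hn1, hn2⟩ := exists_nat_pow_near ht (one_lt_two (α := ℝ))
  refine ⟨n + 1, by rw [pow_succ]; linarith, ?_⟩
  refine H (n + 1) _
    (measurable_duhamelSymbol ha.continuous hb.continuous hc.continuous hm.continuous t)
    (fun x => ?_) (fun x => ?_) (fun x hx => duhamelSymbol_eq_zero
      (image_eq_zero_of_notMem_tsupport fun hx' => hx (hK hx')) t)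
  · refine (norm_duhamelSymbol_le t x).trans ?_
    rw [abs_of_nonneg (by linarith), hM']
    have h1 : Real.sqrt (2 * Real.pi) * ‖m x‖ ≤ 2 * Real.sqrt (2 * Real.pi) * M := by
      have h2 : Real.sqrt (2 * Real.pi) * ‖m x‖ ≤ Real.sqrt (2 * Real.pi) * M := by
        gcongr; exact hmM x
      have h3 : 0 ≤ Real.sqrt (2 * Real.pi) * M := by positivity
      linarith
    gcongr
  · refine (norm_duhamelSymbol_mul_le t x).trans ?_
    rw [hM']; gcongr; exact hmM x

/-- The dyadic sum handles `t ≥ 1`. For `t ≤ 1` the linear bound is enough, because `e ≤ 1` gives `t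
≤ t^e`. -/
lemma solutionBound_rpow (ha : ContDiff ℝ ∞ a) (hb : ContDiff ℝ ∞ b)
    (hc : ContDiff ℝ ∞ c) (hm : ContDiff ℝ ∞ m) (hms : HasCompactSupport m) (hq : 2 ≤ q) {p r : ℝ}
    (hp : 0 ≤ p) (hr : 0 ≤ r)
    (h : ∀ P ∈ timeResonantSet a b c,
      LocalSublevel (phase a b c) p r P ∨ LocalSublevel (phase a b c) r p P)
    {e : ℝ} (he : 1 - sublevelExponent q p r = e) (he0 : 0 < e) (he1 : e ≤ 1) :
    SolutionBound a b c m q (fun t => t ^ e) := by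
  refine solutionBound_of_multiplierBound ha hb hc hm hms ?_
  obtain ⟨C, hC, H⟩ := exists_multiplierBound_of_localSublevel ha hb hc hm hms hq hp hr h
  obtain ⟨C', hC', H'⟩ := exists_multiplierBound_mul_time ha.continuous hb.continuous
    hc.continuous hm.continuous hms hq
  obtain ⟨G, hG, HG⟩ := geom_sum_le_rpow (κ := sublevelExponent q p r) (by linarith)
  refine ⟨C * G + C', fun t ht => ?_⟩
  rcases le_total 1 t with h1 | h1
  · obtain ⟨J, hJ, hb⟩ := H t h1
    refine hb.mono ?_
    have h2 := HG t J (by linarith) hJ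
    rw [he] at h2
    have h3 : 0 ≤ t ^ e := Real.rpow_nonneg ht e
    have h4 := mul_le_mul_of_nonneg_left h2 hC
    rw [he]
    nlinarith
  · refine (H' t ht).mono ?_
    have h2 : t ≤ t ^ e := by
      rcases ht.eq_or_lt with h0 | h0
      · rw [← h0]; exact Real.rpow_nonneg le_rfl e
      · simpa using Real.rpow_le_rpow_of_exponent_ge h0 h1 he1
    have h3 : 0 ≤ C * G * t ^ e := by positivity
    have h4 := mul_le_mul_of_nonneg_left h2 hC'
    linarith

/-- As for powers, with the short times covered by the linear bound because the bracket is at least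
`1`. -/
lemma solutionBound_log (ha : ContDiff ℝ ∞ a) (hb : ContDiff ℝ ∞ b)
    (hc : ContDiff ℝ ∞ c) (hm : ContDiff ℝ ∞ m) (hms : HasCompactSupport m) (hq : 2 ≤ q) {p r : ℝ}
    (hp : 0 ≤ p) (hr : 0 ≤ r)
    (h : ∀ P ∈ timeResonantSet a b c,
      LocalSublevel (phase a b c) p r P ∨ LocalSublevel (phase a b c) r p P)
    (he : sublevelExponent q p r = 1) :
    SolutionBound a b c m q (fun t => japaneseBracket (Real.log t)) := by
  refine solutionBound_of_multiplierBound ha hb hc hm hms ?_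
  obtain ⟨C, hC, H⟩ := exists_multiplierBound_of_localSublevel ha hb hc hm hms hq hp hr h
  obtain ⟨C', hC', H'⟩ := exists_multiplierBound_mul_time ha.continuous hb.continuous
    hc.continuous hm.continuous hms hq
  refine ⟨C * 4 + C', fun t ht => ?_⟩
  have h3 : 1 ≤ japaneseBracket (Real.log t) :=
    Real.one_le_sqrt.2 (by have := sq_nonneg (Real.log t); linarith)
  rcases le_total 1 t with h1 | h1
  · obtain ⟨J, hJ, hb⟩ := H t h1
    refine hb.mono ?_
    have h2 := geom_sum_le_log h1 hJ
    rw [he]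
    have h4 := mul_le_mul_of_nonneg_left h2 hC
    nlinarith
  · refine (H' t ht).mono ?_
    have h2 := mul_le_mul_of_nonneg_left (h1.trans h3) hC'
    nlinarith

end Bounds

end

/-! ### The main theorem: exponents for each geometry -/

theorem theorem3p1 (a b c : ℝ → ℝ)
    (ha : ContDiff ℝ ∞ a) (hb : ContDiff ℝ ∞ b) (hc : ContDiff ℝ ∞ c)
    (m : ℝ × ℝ → ℂ) (hm : ContDiff ℝ ∞ m) (hms : HasCompactSupport m) :
    (∀ f g : L2, ∃! U : (ℝ → L2) × (ℝ → L2) × (ℝ → L2), IsSolution a b c m f g U) ∧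
    ∀ q : ℝ≥0∞, 2 ≤ q →
      SolutionBound a b c m q (fun t => t) ∧
      (timeResonantSet a b c = ∅ → SolutionBound a b c m q (fun _ => 1)) ∧
      ((∃ p₀ : ℝ × ℝ, timeResonantSet a b c = {p₀} ∧ VanishesAtOrderTwo (phase a b c) p₀) →
        SolutionBound a b c m q (fun t => t ^ (1 / 2 + recip q / 2))) ∧
      (IsNonCharacteristicCurve (timeResonantSet a b c) →
        (∀ p ∈ timeResonantSet a b c, VanishesAtOrderOne (phase a b c) p) →
        (q ≠ ⊤ → SolutionBound a b c m q (fun t => t ^ recip q)) ∧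
        (q = ⊤ → SolutionBound a b c m q (fun t => japaneseBracket (Real.log t)))) ∧
      (IsCurvedCurve (timeResonantSet a b c) →
        (∀ p ∈ timeResonantSet a b c, VanishesAtOrderOne (phase a b c) p) →
        SolutionBound a b c m q (fun t => t ^ (1 / 4 + recip q / 2))) ∧
      (IsSmoothCurve (timeResonantSet a b c) →
        (∀ p ∈ timeResonantSet a b c, VanishesAtOrderOne (phase a b c) p) →
        SolutionBound a b c m q (fun t => t ^ (1 / 2 : ℝ))) := by
  have hφ := contDiff_phase ha hb hc
  have hac := ha.continuous
  have hbc := hb.continuous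
  have hcc := hc.continuous
  have hmc := hm.continuous
  refine ⟨fun f g => ?_, fun q hq => ?_⟩
  · obtain ⟨U, hU, -⟩ := exists_solution ha hb hc hm hms f g
    exact ⟨U, hU, fun V hV => IsSolution.unique ha hb hc hV hU⟩
  have hr0 := recip_nonneg q
  have hr1 := recip_le_half hq
  refine ⟨?_, fun hΓ => ?_, ?_, fun hΓ h1 => ?_, fun hΓ h1 => ?_, fun hΓ h1 => ?_⟩
  · obtain ⟨C, -, hC⟩ := exists_multiplierBound_mul_time hac hbc hcc hmc hms hq
    exact solutionBound_of_multiplierBound ha hb hc hm hms ⟨C, hC⟩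
  · exact solutionBound_of_multiplierBound ha hb hc hm hms
      (exists_multiplierBound_of_nonresonant hac hbc hcc hmc hms hq hΓ)
  · rintro ⟨p₀, hΓ, h2⟩
    -- Here `κ = 1/2 - 1/(2q)`.
    refine solutionBound_rpow ha hb hc hm hms hq (p := 1 / 2) (r := 1 / 2) (by norm_num)
      (by norm_num) (fun P hP => ?_) ?_ (by linarith) (by linarith)
    · rw [hΓ, mem_singleton_iff] at hP
      rw [hP]
      exact Or.inl (localSublevel_of_orderTwo hφ h2)
    · rw [sublevelExponent, max_self]; ring
  · have hl : ∀ P ∈ timeResonantSet a b c,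
        LocalSublevel (phase a b c) 1 1 P ∨ LocalSublevel (phase a b c) 1 1 P := by
      intro P hP
      obtain ⟨γ, hγ, hc⟩ := hΓ P hP
      exact Or.inl (localSublevel_of_nonCharacteristic hφ (h1 P hP) hγ hc)
    refine ⟨fun hq' => ?_, fun hq' => ?_⟩
    · refine solutionBound_rpow ha hb hc hm hms hq (by norm_num) (by norm_num) hl ?_
        (recip_pos hq hq') (by linarith)
      rw [sublevelExponent, max_self]; ring
    · refine solutionBound_log ha hb hc hm hms hq (by norm_num) (by norm_num) hl ?_
      rw [sublevelExponent, max_self, hq', recip_top]; norm_num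
  · refine solutionBound_rpow ha hb hc hm hms hq (p := 1) (r := 1 / 2) (by norm_num)
      (by norm_num) (fun P hP => ?_) ?_ (by linarith) (by linarith)
    · obtain ⟨γ, hγ, hc⟩ := hΓ P hP
      exact localSublevel_of_curved hφ (h1 P hP) hγ hc
    · rw [sublevelExponent, max_eq_left (by norm_num)]; ring
  · refine solutionBound_rpow ha hb hc hm hms hq (p := 1) (r := 0) (by norm_num)
      le_rfl (fun P hP => localSublevel_of_orderOne hφ (h1 P hP)) ?_ (by norm_num) (by norm_num)
    rw [sublevelExponent, max_eq_left (by norm_num)]; ring
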